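/- **The scheme.** Let $\lambda,\Delta x>0$, $\Delta t=\Delta x/\lambda$. The linear D3Q27 lattice Boltzmann scheme has the 27 velocities $v_j\in\lambda\{-1,0,1\}^3$. Its moments are $m=Mf$, $M_{kj}=p_k(v_j)$, where, with $v=(x,y,z)$ and $n=x^2+y^2+z^2$, the polynomials $p_k$ are: $p_0=1$; $p_{1,2,3}=x,y,z$; $p_4=n-2\lambda^2$ ($\varepsilon$); $p_5=2x^2-y^2-z^2$ ($XX$); $p_6=y^2-z^2$ ($WW$); $p_{7,8,9}=xy,\,yz,\,zx$ ($XY,YZ,ZX$); $p_{10,11,12}=(x,y,z)(3n-7\lambda^2)$ ($q$); $p_{13,14,15}=\tfrac12(x,y,z)(9n^2-39\lambda^2n+38\lambda^4)$ ($r$); $p_{16}=\tfrac12(3n^2-11\lambda^2n+8\lambda^4)$ ($\varepsilon_2$); $p_{17}=\tfrac12(9n^3-45\lambda^2n^2+60\lambda^4n-16\lambda^6)$ ($\varepsilon_3$); $p_{18}=(2x^2-y^2-z^2)(3n-5\lambda^2)$ ($XX_e$); $p_{19}=(y^2-z^2)(3n-5\lambda^2)$ ($WW_e$); $p_{20,21,22}=(xy,\,yz,\,zx)(3n-8\lambda^2)$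 ($XY_e,YZ_e,ZX_e$); $p_{23,24,25}=x(y^2-z^2),\,y(z^2-x^2),\,z(x^2-y^2)$; $p_{26}=xyz$. The conserved moments are $W=(\rho,J)=(m_0,\dots,m_3)$. For $k\ge 4$ the relaxation is $m_k^*=m_k+s_k(m_k^{\rm eq}-m_k)$ with $s_k>0$ and $m_k^{\rm eq}$ an arbitrary linear function of $W$; the conserved moments are unchanged, $f^*=M^{-1}m^*$, and $f_j(x,t+\Delta t)=f_j^*(x-v_j\Delta t,t)$. Put $\sigma_k=\frac1{s_k}-\frac12$. The formal Taylor expansion in $\Delta t$, with $Y=(m_k)_{k\ge4}=\sum_{n\ge0}\Delta t^n\beta_nW$, gives the equivalent equations $\partial_tW=\sum_{j\ge1}\Delta t^{j-1}\alpha_jW$, where $\alpha_j$, $\beta_n$ are matrices of constant-coefficient space differential operators, homogeneous of order $j$, resp. $n$. The scheme is *isotropic at order $\ell$* if the truncated system $\partial_tW-\sum_{j=1}^{\ell}\Delta t^{j-1}\alpha_jW=0$ is of the rotation invariant form $$\partial_t\rho+\sum_k(a_k\triangle^k\rho+b_k\,{\rm div}\triangle^kJ)=0,\qquad \partial_tJ+\sum_k(d_k\nabla\triangle^k\rho+m_k\triangle^kJ+e_k\nabla{\rm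 div}\triangle^kJ+f_k\,{\rm curl}\,\triangle^kJ)=0$$ with finite sums and real coefficients. **The result.** Suppose $\varepsilon^{\rm eq}=\alpha\lambda^2\rho$ and $XX^{\rm eq}=WW^{\rm eq}=XY^{\rm eq}=YZ^{\rm eq}=ZX^{\rm eq}=0$. Put $c_0^2=\frac{\alpha+2}{3}\lambda^2$. 1. *First order.* The scheme is isotropic at order 1, and the system truncated at order 1 is $\partial_t\rho+{\rm div}J=0$, $\partial_tJ+c_0^2\nabla\rho=0$. 2. *Second order.* If $\sigma_5=\sigma_6$, $\sigma_7=\sigma_8=\sigma_9$, $\sigma_5+2\sigma_7\ne0$, and $$q^{\rm eq}=2\,\frac{\sigma_5-4\sigma_7}{\sigma_5+2\sigma_7}\,\lambda^2J,\qquad m_{23}^{\rm eq}=m_{24}^{\rm eq}=m_{25}^{\rm eq}=m_{26}^{\rm eq}=0,$$ then the scheme is isotropic at order 2, and the system truncated at order 2 is $\partial_t\rho+{\rm div}J=0$, $\partial_tJ+c_0^2\nabla\rho-\mu\triangle J-\zeta\nabla{\rm div}J=0$ with $$\mu=\frac{\sigma_5\sigma_7}{\sigma_5+2\sigma_7}\lambda\Delta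 x,\qquad \zeta_b\equiv3\zeta-\mu=\frac{\lambda\sigma_4\Delta x}{\sigma_5+2\sigma_7}\bigl(\sigma_5-2\sigma_7-\alpha\sigma_5-2\alpha\sigma_7\bigr).$$ Conversely, if $0<s_k<2$ for all $k\ge4$ and the scheme is isotropic at order 2, then $\sigma_5=\sigma_6$, $\sigma_7=\sigma_8=\sigma_9$, and $q^{\rm eq}$, $m_{23}^{\rm eq},\dots,m_{26}^{\rm eq}$ have the values above. 3. *Third order.* Suppose $\sigma_5=\sigma_6=\sigma_7=\sigma_8=\sigma_9$, $q^{\rm eq}=-2\lambda^2J$, $m_{23}^{\rm eq}=\dots=m_{26}^{\rm eq}=0$, $XX_e^{\rm eq}=WW_e^{\rm eq}=XY_e^{\rm eq}=YZ_e^{\rm eq}=ZX_e^{\rm eq}=0$, and either (a) $\varepsilon_2^{\rm eq}=-(2+3\alpha)\lambda^4\rho$, or (b) $\varepsilon_2^{\rm eq}=\beta\lambda^4\rho$ for some $\beta\in\mathbb R$, $\sigma_5\neq0$, $\sigma_{10}=\sigma_{11}=\sigma_{12}=\sigma_{23}=\frac1{12\sigma_5}$, $\sigma_{24}=\frac1{4\sigma_5}$,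 $\sigma_{25}=\frac1{8\sigma_5}$. Then the scheme is isotropic at order 3, and the system truncated at order 3 is $\partial_t\rho+{\rm div}J+\xi\triangle{\rm div}J=0$, $\partial_tJ+c_0^2\nabla\rho-\mu\triangle J-\zeta\nabla{\rm div}J+\chi\nabla\triangle\rho=0$ with $$\mu=\tfrac13\sigma_5\lambda\Delta x,\qquad \zeta_b\equiv 3\zeta-\mu=-\tfrac13\sigma_4(1+3\alpha)\lambda\Delta x,\qquad \xi=\tfrac1{36}(\alpha-1)\Delta x^2,$$ and in case (a) $$\chi=\tfrac1{54}(\alpha+2)\bigl(1-\alpha+6\alpha\sigma_4^2+2\sigma_4^2-8\sigma_5^2\bigr)\lambda^2\Delta x^2,$$ in case (b) $$\chi=\tfrac1{162\sigma_5}\bigl(4\sigma_5+2\sigma_4+3\alpha\sigma_4-6\alpha\sigma_5-3\alpha^2\sigma_5+18\alpha^2\sigma_4^2\sigma_5+42\alpha\sigma_4^2\sigma_5+12\sigma_4^2\sigma_5-24\alpha\sigma_5^3-48\sigma_5^3+\beta\sigma_4-\beta\sigma_5\bigr)\lambda^2\Delta x^2.$$ -/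

import Mathlib

namespace LBM

/-- Linear differential operators in three space variables with constant real coefficients,
as polynomials in `∂₀ = ∂_x`, `∂₁ = ∂_y`, `∂₂ = ∂_z`; the product is the composition. -/
abbrev Op := MvPolynomial (Fin 3) ℝ

/-- The partial derivative `∂_i`. -/
noncomputable def pd (i : Fin 3) : Op := MvPolynomial.X i

/-- The Laplace operator. -/
noncomputable def lap : Op := ∑ i, pd i ^ 2

/-- The curl, as a matrix of operators acting on vector fields. -/
noncomputable def curl : Matrix (Fin 3) (Fin 3) Op :=
  !![0, -pd 2, pd 1; pd 2, 0, -pd 0; -pd 1, pd 0, 0]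

/-- The operator on `W = (ρ, J_x, J_y, J_z)` with the given blocks:
`W ↦ (a ρ + ∑ b_j J_j, c_i ρ + ∑ d_ij J_j)`. -/
def blockOp (a : Op) (b c : Fin 3 → Op) (d : Matrix (Fin 3) (Fin 3) Op) :
    Matrix (Fin 4) (Fin 4) Op :=
  Matrix.of (Fin.cons (Fin.cons a b) (fun i => Fin.cons (c i) (d i)))

/-- The system `∂_t W + G W = 0` of acoustic type is of the general form that is invariant by
rotations in three dimensions:
`∂_t ρ + ∑ₖ (aₖ Δᵏ ρ + bₖ div Δᵏ J) = 0`,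
`∂_t J + ∑ₖ (dₖ ∇ Δᵏ ρ + mₖ Δᵏ J + eₖ ∇ div Δᵏ J + fₖ curl Δᵏ J) = 0`, with finite sums. -/
def IsRotationInvariant (G : Matrix (Fin 4) (Fin 4) Op) : Prop :=
  ∃ (n : ℕ) (a b d m e f : ℕ → ℝ),
    G = ∑ k ∈ Finset.range n, blockOp
      (a k • lap ^ k)
      (fun j => b k • (pd j * lap ^ k))
      (fun i => d k • (pd i * lap ^ k))
      (Matrix.of fun i j => (if i = j then m k • lap ^ k else 0)
        + e k • (pd i * pd j * lap ^ k) + f k • (curl i j * lap ^ k))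

/-- The operator `G` of the isotropic acoustic system `∂_t W + G W = 0`, that is
`∂_t ρ + div J + ξ Δ div J = 0`,
`∂_t J + c₀² ∇ρ - μ ΔJ - ζ ∇ div J + χ ∇Δρ = 0`, where `c2 = c₀²`. -/
noncomputable def acousticOp (c2 μ ζ ξ χ : ℝ) : Matrix (Fin 4) (Fin 4) Op :=
  blockOp 0
    (fun j => pd j + ξ • (lap * pd j))
    (fun i => c2 • pd i + χ • (pd i * lap))
    (Matrix.of fun i j => (if i = j then -(μ • lap) else 0) - ζ • (pd i * pd j))

/-- `powCoeff a j p` is the coefficient of `Δt ^ p` in the `j`-th power of the formal series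
`∑ₗ Δtˡ a l` (with non-commuting coefficients). -/
noncomputable def powCoeff (a : ℕ → Matrix (Fin 4) (Fin 4) Op) :
    ℕ → ℕ → Matrix (Fin 4) (Fin 4) Op
  | 0, p => if p = 0 then 1 else 0
  | j + 1, p => ∑ l ∈ Finset.range (p + 1), a l * powCoeff a j (p - l)

/-- The formal expansion of a linear scheme with derivation matrices `(Aₙ, Bₙ; Cₙ, Dₙ)`,
equilibrium matrix `E` and relaxation matrix `S`, with `T = S⁻¹`:
`Y = ∑ₖ Δtᵏ βₖ W` and `∂_t W = ∑ₖ Δtᵏ α_{k+1} W`.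
Identifying the powers of `Δt` in the two block lines of
`exp(Δt ∂_t) (W, Y) = ∑ₙ Δtⁿ (Aₙ, Bₙ; Cₙ, Dₙ) (W, Y)` gives
`β₀ = E`,
`S βₖ = Cₖ + ∑_{j=1}^{k} D_j β_{k-j} - ∑_{j=1}^{k} (1/j!) Kʲₖ` for `k ≥ 1`, and
`α_{k+1} = A_{k+1} + ∑_{j=1}^{k+1} B_j β_{k+1-j} - ∑_{j=2}^{k+1} (1/j!) Γʲ_{k+1}`,
where `Γʲ_{j+p}` and `Kʲ_{j+p}` are the coefficients of `Δtᵖ` in `(∑ₗ Δtˡ α_{l+1})ʲ` and in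
`(∑ₘ Δtᵐ βₘ) (∑ₗ Δtˡ α_{l+1})ʲ`.
For `l < k`, the first component of `expansion A B C D E T k` has the value `α_{l+1}` at `l`,
and the second component has the value `βₗ`. -/
noncomputable def expansion
    (A : ℕ → Matrix (Fin 4) (Fin 4) Op) (B : ℕ → Matrix (Fin 4) (Fin 23) Op)
    (C : ℕ → Matrix (Fin 23) (Fin 4) Op) (D : ℕ → Matrix (Fin 23) (Fin 23) Op)
    (E : Matrix (Fin 23) (Fin 4) Op) (T : Matrix (Fin 23) (Fin 23) Op) :
    ℕ → (ℕ → Matrix (Fin 4) (Fin 4) Op) × (ℕ → Matrix (Fin 23) (Fin 4) Op)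
  | 0 => (0, 0)
  | k + 1 =>
    let a := (expansion A B C D E T k).1
    let b := (expansion A B C D E T k).2
    let bk : Matrix (Fin 23) (Fin 4) Op :=
      if k = 0 then E
      else T *
        (C k + ∑ j ∈ Finset.Icc 1 k, D j * b (k - j)
          - ∑ j ∈ Finset.Icc 1 k, ((j.factorial : ℝ)⁻¹) •
              ∑ l ∈ Finset.range (k - j + 1), b l * powCoeff a j (k - j - l))
    let b' := Function.update b k bk
    let ak : Matrix (Fin 4) (Fin 4) Op :=
      A (k + 1) + ∑ j ∈ Finset.Icc 1 (k + 1), B j * b' (k + 1 - j)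
        - ∑ j ∈ Finset.Icc 2 (k + 1), ((j.factorial : ℝ)⁻¹) • powCoeff a j (k + 1 - j)
    (Function.update a k ak, b')

/-- The parameters of a linear D3Q27 scheme with multiple relaxation times and with the four
conserved moments `W = (ρ, J_x, J_y, J_z) = (m₀, m₁, m₂, m₃)`.
For `4 ≤ k`, the moment `m_k` relaxes by `m_k* = m_k + s_k (m_k^eq - m_k)`, where
`m_k^eq = ∑ i, E k i * W i`. The entries `s k` and `E k` with `k < 4` are not used. -/
structure D3Q27 where
  /-- the numerical velocity `λ = Δx / Δt` -/
  lam : ℝ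
  /-- the space step `Δx` -/
  dx : ℝ
  /-- the relaxation coefficients -/
  s : Fin 27 → ℝ
  /-- the equilibrium coefficients -/
  E : Matrix (Fin 27) (Fin 4) ℝ

namespace D3Q27

/-- The time step. -/
noncomputable def dt (L : D3Q27) : ℝ := L.dx / L.lam

/-- Hénon's parameters. -/
noncomputable def sigma (L : D3Q27) (k : Fin 27) : ℝ := 1 / L.s k - 1 / 2

/-- The 27 velocities `λ (a, b, c)` with `a, b, c ∈ {-1, 0, 1}`. -/
def velocity (L : D3Q27) (j : Fin 27) (i : Fin 3) : ℝ :=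
  L.lam * ((((j : ℕ) / 3 ^ (i : ℕ) % 3 : ℕ) : ℝ) - 1)

/-- The moment polynomials `p_k` (mutually orthogonal on the set of velocities). -/
noncomputable def momentPoly (lam : ℝ) (v : Fin 3 → ℝ) : Fin 27 → ℝ :=
  let x := v 0
  let y := v 1
  let z := v 2
  let n := x ^ 2 + y ^ 2 + z ^ 2
  ![
    -- 0: density
    1,
    -- 1, 2, 3: momentum
    x, y, z,
    -- 4: energy
    n - 2 * lam ^ 2,
    -- 5, 6: XX, WW
    2 * x ^ 2 - y ^ 2 - z ^ 2, y ^ 2 - z ^ 2,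
    -- 7, 8, 9: XY, YZ, ZX
    x * y, y * z, z * x,
    -- 10, 11, 12: q
    x * (3 * n - 7 * lam ^ 2), y * (3 * n - 7 * lam ^ 2), z * (3 * n - 7 * lam ^ 2),
    -- 13, 14, 15: r
    x * (9 * n ^ 2 - 39 * lam ^ 2 * n + 38 * lam ^ 4) / 2,
    y * (9 * n ^ 2 - 39 * lam ^ 2 * n + 38 * lam ^ 4) / 2,
    z * (9 * n ^ 2 - 39 * lam ^ 2 * n + 38 * lam ^ 4) / 2,
    -- 16: square of the energy
    (3 * n ^ 2 - 11 * lam ^ 2 * n + 8 * lam ^ 4) / 2,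
    -- 17: cube of the energy
    (9 * n ^ 3 - 45 * lam ^ 2 * n ^ 2 + 60 * lam ^ 4 * n - 16 * lam ^ 6) / 2,
    -- 18, 19: XX_e, WW_e
    (2 * x ^ 2 - y ^ 2 - z ^ 2) * (3 * n - 5 * lam ^ 2),
    (y ^ 2 - z ^ 2) * (3 * n - 5 * lam ^ 2),
    -- 20, 21, 22: XY_e, YZ_e, ZX_e
    x * y * (3 * n - 8 * lam ^ 2), y * z * (3 * n - 8 * lam ^ 2), z * x * (3 * n - 8 * lam ^ 2),
    -- 23, 24, 25: antisymmetric moments of order 3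
    x * (y ^ 2 - z ^ 2), y * (z ^ 2 - x ^ 2), z * (x ^ 2 - y ^ 2),
    -- 26: XYZ
    x * y * z]

/-- The matrix `M` that maps the particle distribution `f` to the moments `m`. -/
noncomputable def momentMatrix (L : D3Q27) : Matrix (Fin 27) (Fin 27) ℝ :=
  Matrix.of fun k j => momentPoly L.lam (L.velocity j) k

/-- The equilibrium matrix of the 23 non-conserved moments `Y_l = m_{4+l}`. -/
def slaveE (L : D3Q27) : Matrix (Fin 23) (Fin 4) ℝ :=
  Matrix.of fun l i => L.E (Fin.natAdd 4 l) i

/-- The relaxation coefficients of the non-conserved moments. -/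
def slaveS (L : D3Q27) : Fin 23 → ℝ := fun l => L.s (Fin.natAdd 4 l)

/-- The relaxation `m* = J₀ m` in terms of `m = (W, Y)`. -/
def relaxation (L : D3Q27) : Matrix (Fin 4 ⊕ Fin 23) (Fin 4 ⊕ Fin 23) ℝ :=
  Matrix.fromBlocks 1 0 (Matrix.diagonal L.slaveS * L.slaveE) (1 - Matrix.diagonal L.slaveS)

/-- The term of order `n` of the Taylor expansion in `Δt` of the propagation step
`f_j(x, t + Δt) = f_j*(x - v_j Δt, t)`, written for the moments:
`(1 / n!) M diag((- v_j · ∇)ⁿ) M⁻¹`. -/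
noncomputable def propagation (L : D3Q27) (n : ℕ) : Matrix (Fin 27) (Fin 27) Op :=
  L.momentMatrix.map MvPolynomial.C
    * Matrix.diagonal (fun j =>
        ((n.factorial : ℝ)⁻¹) • (-∑ i, L.velocity j i • pd i) ^ n)
    * (L.momentMatrix⁻¹).map MvPolynomial.C

/-- The derivation matrix of order `n` of one time step, by blocks for `m = (W, Y)`:
`m(t + Δt) = ∑ₙ Δtⁿ (derivation n) m(t)`. -/
noncomputable def derivation (L : D3Q27) (n : ℕ) :
    Matrix (Fin 4 ⊕ Fin 23) (Fin 4 ⊕ Fin 23) Op :=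
  (L.propagation n).submatrix finSumFinEquiv finSumFinEquiv
    * L.relaxation.map MvPolynomial.C

/-- The block `A_n` of the derivation matrix. -/
noncomputable def A (L : D3Q27) (n : ℕ) : Matrix (Fin 4) (Fin 4) Op :=
  (L.derivation n).toBlocks₁₁

/-- The block `B_n` of the derivation matrix. -/
noncomputable def B (L : D3Q27) (n : ℕ) : Matrix (Fin 4) (Fin 23) Op :=
  (L.derivation n).toBlocks₁₂

/-- The block `C_n` of the derivation matrix. -/
noncomputable def C (L : D3Q27) (n : ℕ) : Matrix (Fin 23) (Fin 4) Op :=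
  (L.derivation n).toBlocks₂₁

/-- The block `D_n` of the derivation matrix. -/
noncomputable def D (L : D3Q27) (n : ℕ) : Matrix (Fin 23) (Fin 23) Op :=
  (L.derivation n).toBlocks₂₂

/-- The operator `α_j`, `j ≥ 1`, of the equivalent partial differential equations
`∂_t W = ∑_{j ≥ 1} Δt^{j-1} α_j W`. -/
noncomputable def alpha (L : D3Q27) : ℕ → Matrix (Fin 4) (Fin 4) Op
  | 0 => 0
  | j + 1 => (expansion L.A L.B L.C L.D (L.slaveE.map MvPolynomial.C)
      (Matrix.diagonal fun l => MvPolynomial.C (1 / L.slaveS l)) (j + 1)).1 j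

/-- The operator `G` of the equivalent system `∂_t W + G W = 0` truncated at order `l`:
`G = - ∑_{j=1}^{l} Δt^{j-1} α_j`. -/
noncomputable def equivOp (L : D3Q27) (l : ℕ) : Matrix (Fin 4) (Fin 4) Op :=
  -∑ j ∈ Finset.Icc 1 l, L.dt ^ (j - 1) • L.alpha j

/-- The scheme is invariant by rotation (isotropic) at order `l`. -/
def IsotropicAtOrder (L : D3Q27) (l : ℕ) : Prop := IsRotationInvariant (L.equivOp l)

/-- The equilibrium values of the moments of degree two: `ε^eq = α λ² ρ` and
`XX^eq = WW^eq = XY^eq = YZ^eq = ZX^eq = 0`. -/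
def FirstOrderEquilibrium (L : D3Q27) (α : ℝ) : Prop :=
  L.E 4 = ![α * L.lam ^ 2, 0, 0, 0] ∧
  L.E 5 = 0 ∧ L.E 6 = 0 ∧ L.E 7 = 0 ∧ L.E 8 = 0 ∧ L.E 9 = 0

/-- The heat flux at equilibrium is `q^eq = κ λ² J`. -/
def HeatFluxEquilibrium (L : D3Q27) (κ : ℝ) : Prop :=
  L.E 10 = ![0, κ * L.lam ^ 2, 0, 0] ∧
  L.E 11 = ![0, 0, κ * L.lam ^ 2, 0] ∧
  L.E 12 = ![0, 0, 0, κ * L.lam ^ 2]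

/-- The moments 23, 24, 25 (antisymmetric of order three) and 26 (`XYZ`) vanish at
equilibrium. -/
def NullThirdOrderEquilibrium (L : D3Q27) : Prop :=
  L.E 23 = 0 ∧ L.E 24 = 0 ∧ L.E 25 = 0 ∧ L.E 26 = 0

/-- The relations `σ₅ = σ₆` and `σ₇ = σ₈ = σ₉`. -/
def SecondOrderRelaxation (L : D3Q27) : Prop :=
  L.sigma 5 = L.sigma 6 ∧ L.sigma 7 = L.sigma 8 ∧ L.sigma 8 = L.sigma 9

/-- The equilibrium values `ε₂^eq = b λ⁴ ρ` and
`XX_e^eq = WW_e^eq = XY_e^eq = YZ_e^eq = ZX_e^eq = 0`. -/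
def FourthDegreeEquilibrium (L : D3Q27) (b : ℝ) : Prop :=
  L.E 16 = ![b * L.lam ^ 4, 0, 0, 0] ∧
  L.E 18 = 0 ∧ L.E 19 = 0 ∧ L.E 20 = 0 ∧ L.E 21 = 0 ∧ L.E 22 = 0

end D3Q27

end LBM

/-! One time step is a relaxation followed by the exponential of a first order operator: the Taylor
coefficients of the propagation are Λⁿ/n!, where Λ is the conjugate by M of the diagonal matrix of
the transports -v_j·∇ (`D3Q27.isExponential`). Write Λ in blocks (a, b; c, d), let Ψ = c + dE - E(a
+ bE) be the defect of conservation at equilibrium and let Σ = T - 1/2 carry the σ_k. The recursion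
for the α_j then collapses to α₁ = a + bE, α₂ = bΣΨ, α₃ = bΣ(dΣΨ - ΣΨα₁ - Eα₂) - (abΨ + bdΨ)/12 +
bΨα₁/6, which are noncommutative polynomial identities (`IsExponential.expansion_two`,
`IsExponential.expansion_three`).

The rows of Λ are found without inverting M explicitly. Row k expands -(v·x)p_k(v) in the basis p_l
on the lattice, where v_i³ = λ²v_i. Orthogonality of the p_k makes M invertible, so it suffices to
check each expansion at a single velocity. Up to order three only the rows 0-12 and 23-26 matter.

Operators are compared through their values at real wave vectors x. At second order, with q^eq =
κλ²J, isotropy of the viscous term is the balance (2 - κ)σ₅ = 2(4 + κ)σ₇, which fixes κ. At third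
order, with σ₅ = σ₇ and κ = -2, the only anisotropic contribution comes from the defect of q; it is
proportional to (3α + 2 + β)(σ₅σ₁₀ - 1/12) when σ₁₀ = σ₁₁ = σ₁₂. The two families of parameters
annihilate one or the other factor.

For the converse, α₁ is odd in x and the momentum rows of α₂ are even, so parity isolates α₂ and
removes the curl. The remaining coefficients are functions of |x|², hence constants on the sphere of
radius 5. Its points such as (5,0,0) and (3,4,0) give linear equations for the equilibria, which
`D3Q27.isotropic_parameters` solves using σ_k > 0. -/

namespace LBM

/-! ### Closed forms of the first three operators of the formal expansion -/

section Expansion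

variable {A : ℕ → Matrix (Fin 4) (Fin 4) Op} {B : ℕ → Matrix (Fin 4) (Fin 23) Op}
  {C : ℕ → Matrix (Fin 23) (Fin 4) Op} {D : ℕ → Matrix (Fin 23) (Fin 23) Op}
  {E : Matrix (Fin 23) (Fin 4) Op} {S T : Matrix (Fin 23) (Fin 23) Op}
  {a : Matrix (Fin 4) (Fin 4) Op} {b : Matrix (Fin 4) (Fin 23) Op}
  {c : Matrix (Fin 23) (Fin 4) Op} {d : Matrix (Fin 23) (Fin 23) Op}

theorem expansion_one : (expansion A B C D E T 1).1 0 = A 1 + B 1 * E := by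
  simp [expansion]

theorem expansion_two : (expansion A B C D E T 2).1 1 =
    A 2 + B 1 * (T * (C 1 + D 1 * E - E * (A 1 + B 1 * E))) + B 2 * E
      - (1 / 2 : ℝ) • ((A 1 + B 1 * E) * (A 1 + B 1 * E)) := by
  simp [expansion, powCoeff, Finset.sum_Icc_succ_top, Function.update_apply]
  abel

/-- Passing α₁, α₂ and β₁ as named matrices keeps the third step of the recursion from unfolding
into products of earlier steps. -/
theorem expansion_three (α₁ α₂ : Matrix (Fin 4) (Fin 4) Op) (β₁ : Matrix (Fin 23) (Fin 4) Op)
    (h₁ : α₁ = A 1 + B 1 * E) (hβ : β₁ = T * (C 1 + D 1 * E - E * α₁))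
    (h₂ : α₂ = (expansion A B C D E T 2).1 1) :
    (expansion A B C D E T 3).1 2 =
    A 3 + B 1 * (T * (C 2 + D 1 * β₁ + D 2 * E - (E * α₂ + β₁ * α₁) - (1 / 2 : ℝ) • (E * (α₁ * α₁))))
      + B 2 * β₁ + B 3 * E
      - (1 / 2 : ℝ) • (α₁ * α₂ + α₂ * α₁) - (1 / 6 : ℝ) • (α₁ * (α₁ * α₁)) := by
  subst hβ h₁
  -- The unfolded form of α₂ is kept so that its occurrences in the unfolded goal can be folded
  -- back.
  have h₂' := h₂
  simp [expansion, powCoeff, Finset.sum_Icc_succ_top, Function.update_apply] at h₂'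
  simp [expansion, powCoeff, Finset.sum_Icc_succ_top, Finset.sum_range_succ,
    Function.update_apply, Nat.factorial, ← h₂']
  simp only [sub_sub, add_assoc]

/-- The defect of conservation at first order. -/
noncomputable def defect (a : Matrix (Fin 4) (Fin 4) Op) (b : Matrix (Fin 4) (Fin 23) Op)
    (c : Matrix (Fin 23) (Fin 4) Op) (d : Matrix (Fin 23) (Fin 23) Op)
    (E : Matrix (Fin 23) (Fin 4) Op) : Matrix (Fin 23) (Fin 4) Op :=
  c + d * E - E * (a + b * E)

/-- The blocks `A, B, C, D` are those of the powers of `Λ = (a, b; c, d)` divided by `n!`,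
followed by the relaxation. -/
def IsExponential (A : ℕ → Matrix (Fin 4) (Fin 4) Op) (B : ℕ → Matrix (Fin 4) (Fin 23) Op)
    (C : ℕ → Matrix (Fin 23) (Fin 4) Op) (D : ℕ → Matrix (Fin 23) (Fin 23) Op)
    (E : Matrix (Fin 23) (Fin 4) Op) (S : Matrix (Fin 23) (Fin 23) Op)
    (a : Matrix (Fin 4) (Fin 4) Op) (b : Matrix (Fin 4) (Fin 23) Op)
    (c : Matrix (Fin 23) (Fin 4) Op) (d : Matrix (Fin 23) (Fin 23) Op) : Prop :=
  ∀ n, Matrix.fromBlocks (A n) (B n) (C n) (D n) =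
    (((n.factorial : ℝ)⁻¹) • Matrix.fromBlocks a b c d ^ n) *
      Matrix.fromBlocks 1 0 (S * E) (1 - S)

theorem IsExponential.one (h : IsExponential A B C D E S a b c d) :
    A 1 = a + b * (S * E) ∧ B 1 = b * (1 - S) ∧ C 1 = c + d * (S * E) ∧ D 1 = d * (1 - S) := by
  have := h 1
  simp only [Nat.factorial, pow_one, Nat.cast_one, inv_one, one_smul, Matrix.fromBlocks_multiply,
    mul_one, Nat.succ_eq_add_one, zero_add, Matrix.mul_one, Matrix.mul_zero] at this
  exact Matrix.fromBlocks_inj.1 this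

theorem IsExponential.two (h : IsExponential A B C D E S a b c d) :
    A 2 = (1 / 2 : ℝ) • (a * a + b * c + (a * b + b * d) * (S * E)) ∧
    B 2 = (1 / 2 : ℝ) • ((a * b + b * d) * (1 - S)) ∧
    C 2 = (1 / 2 : ℝ) • (c * a + d * c + (c * b + d * d) * (S * E)) ∧
    D 2 = (1 / 2 : ℝ) • ((c * b + d * d) * (1 - S)) := by
  have := h 2
  rw [pow_two, Matrix.smul_mul, Matrix.fromBlocks_multiply, Matrix.fromBlocks_multiply,
    Matrix.fromBlocks_smul] at this
  simpa [Nat.factorial] using Matrix.fromBlocks_inj.1 this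

theorem IsExponential.three (h : IsExponential A B C D E S a b c d) :
    A 3 = (1 / 6 : ℝ) • (a * (a * a + b * c) + b * (c * a + d * c)
      + (a * (a * b + b * d) + b * (c * b + d * d)) * (S * E)) ∧
    B 3 = (1 / 6 : ℝ) • ((a * (a * b + b * d) + b * (c * b + d * d)) * (1 - S)) := by
  have := h 3
  rw [pow_succ', pow_two, Matrix.smul_mul, Matrix.fromBlocks_multiply, Matrix.fromBlocks_multiply,
    Matrix.fromBlocks_multiply, Matrix.fromBlocks_smul] at this
  have h' := Matrix.fromBlocks_inj.1 this
  simpa [Nat.factorial] using And.intro h'.1 h'.2.1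

theorem IsExponential.expansion_one (h : IsExponential A B C D E S a b c d) :
    (expansion A B C D E T 1).1 0 = a + b * E := by
  obtain ⟨hA, hB, -, -⟩ := h.one
  rw [LBM.expansion_one, hA, hB]
  simp only [Matrix.mul_sub, Matrix.sub_mul, Matrix.mul_one, Matrix.mul_assoc]
  abel

theorem IsExponential.firstSlave (h : IsExponential A B C D E S a b c d) :
    C 1 + D 1 * E - E * (a + b * E) = defect a b c d E := by
  obtain ⟨-, -, hC, hD⟩ := h.one
  rw [hC, hD, defect]
  simp only [Matrix.mul_sub, Matrix.sub_mul, Matrix.mul_one, Matrix.mul_assoc]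
  abel

/-- The relaxed slave moments contribute b(1 - S)TΨ = bTΨ - bΨ, while the quadratic terms of the
exponential minus α₁²/2 leave bΨ/2; together they replace T by T - 1/2. -/
theorem IsExponential.expansion_two (h : IsExponential A B C D E S a b c d) (hST : S * T = 1) :
    (expansion A B C D E T 2).1 1 = b * ((T - (1 / 2 : ℝ) • 1) * defect a b c d E) := by
  have h₁ := h.expansion_one (T := T)
  rw [LBM.expansion_one] at h₁
  rw [LBM.expansion_two, h₁, h.firstSlave, h.one.2.1, h.two.1, h.two.2.1]
  have hST' (X : Matrix (Fin 23) (Fin 4) Op) : S * (T * X) = X := by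
    rw [← Matrix.mul_assoc, hST, Matrix.one_mul]
  generalize hΨ : defect a b c d E = Ψ
  -- Once c is eliminated in favour of Ψ, the remaining blocks are independent letters, and both
  -- sides agree after expansion into noncommutative monomials.
  have hc : c = Ψ - d * E + E * (a + b * E) := by rw [← hΨ, defect]; abel
  subst hc
  simp only [Matrix.mul_sub, Matrix.sub_mul, Matrix.mul_add, Matrix.add_mul, Matrix.mul_one,
    Matrix.one_mul, Matrix.mul_assoc, Matrix.smul_mul, Matrix.mul_smul, hST']
  module

/-- With T = Σ + 1/2, the terms linear in Σ cancel. The quadratic ones assemble into Σ applied to a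
second order defect, and 1/12 and 1/6 are the constants left over when no Σ is present. -/
theorem IsExponential.expansion_three (h : IsExponential A B C D E S a b c d) (hST : S * T = 1)
    (α₁ α₂ : Matrix (Fin 4) (Fin 4) Op) (Ψ Θ : Matrix (Fin 23) (Fin 4) Op)
    (h₁ : α₁ = a + b * E) (hΨ : Ψ = defect a b c d E)
    (hΘ : Θ = (T - (1 / 2 : ℝ) • 1) * Ψ) (h₂ : α₂ = b * Θ) :
    (expansion A B C D E T 3).1 2 =
      b * ((T - (1 / 2 : ℝ) • 1) * (d * Θ - Θ * α₁ - E * α₂))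
        - (1 / 12 : ℝ) • (a * (b * Ψ) + b * (d * Ψ)) + (1 / 6 : ℝ) • (b * (Ψ * α₁)) := by
  have e₁ : α₁ = A 1 + B 1 * E := by rw [← LBM.expansion_one (T := T), h.expansion_one, h₁]
  have e₂ : α₂ = (expansion A B C D E T 2).1 1 := by
    rw [h.expansion_two hST, ← hΨ, ← hΘ, h₂]
  have hβ : T * Ψ = T * (C 1 + D 1 * E - E * α₁) := by rw [h₁, h.firstSlave, hΨ]
  rw [LBM.expansion_three α₁ α₂ (T * Ψ) e₁ hβ e₂, h.one.2.1, h.one.2.2.2, h.two.2.1, h.two.2.2.1,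
    h.two.2.2.2, h.three.1, h.three.2]
  have hST' (X : Matrix (Fin 23) (Fin 4) Op) : S * (T * X) = X := by
    rw [← Matrix.mul_assoc, hST, Matrix.one_mul]
  have hc : c = Ψ - d * E + E * (a + b * E) := by rw [hΨ, defect]; abel
  clear e₁ e₂ hβ hΨ
  subst hc h₂ hΘ h₁
  simp only [Matrix.mul_sub, Matrix.sub_mul, Matrix.mul_add, Matrix.add_mul, Matrix.mul_one,
    Matrix.one_mul, Matrix.mul_assoc, Matrix.smul_mul, Matrix.mul_smul, hST', smul_sub, smul_add]
  module

end Expansion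
-- Invertibility of the moment matrix
namespace D3Q27

/-- The moment polynomials of the unit lattice, with the factors `1 / 2` removed. -/
def intMomentPoly (x y z : ℤ) : Fin 27 → ℤ :=
  let n := x ^ 2 + y ^ 2 + z ^ 2
  ![1, x, y, z, n - 2, 2 * x ^ 2 - y ^ 2 - z ^ 2, y ^ 2 - z ^ 2, x * y, y * z, z * x,
    x * (3 * n - 7), y * (3 * n - 7), z * (3 * n - 7),
    x * (9 * n ^ 2 - 39 * n + 38), y * (9 * n ^ 2 - 39 * n + 38), z * (9 * n ^ 2 - 39 * n + 38),
    3 * n ^ 2 - 11 * n + 8, 9 * n ^ 3 - 45 * n ^ 2 + 60 * n - 16,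
    (2 * x ^ 2 - y ^ 2 - z ^ 2) * (3 * n - 5), (y ^ 2 - z ^ 2) * (3 * n - 5),
    x * y * (3 * n - 8), y * z * (3 * n - 8), z * x * (3 * n - 8),
    x * (y ^ 2 - z ^ 2), y * (z ^ 2 - x ^ 2), z * (x ^ 2 - y ^ 2), x * y * z]

/-- The moment matrix of the unit lattice, up to the factors `1 / 2`. -/
def intMomentMatrix : Matrix (Fin 27) (Fin 27) ℤ :=
  Matrix.of fun k j =>
    intMomentPoly (((j : ℕ) % 3 : ℕ) - 1) (((j : ℕ) / 3 % 3 : ℕ) - 1) (((j : ℕ) / 9 % 3 : ℕ) - 1) k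

/-- The entries are integers, so this is a finite computation. The equivalence also records that the
squared norms do not vanish. -/
theorem intMomentMatrix_orthogonal :
    ∀ k l : Fin 27, (∑ j, intMomentMatrix k j * intMomentMatrix l j = 0) ↔ k ≠ l := by
  decide +kernel

/-- By orthogonality the Gram matrix is diagonal, and its determinant is the product of the nonzero
squared norms. -/
theorem det_intMomentMatrix_ne_zero : intMomentMatrix.det ≠ 0 := by
  have h : intMomentMatrix * intMomentMatrix.transpose =
      Matrix.diagonal fun k => ∑ j, intMomentMatrix k j * intMomentMatrix k j := by
    ext k l
    by_cases hkl : k = l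
    · subst hkl
      simp [Matrix.mul_apply]
    · simpa [Matrix.mul_apply, hkl] using (intMomentMatrix_orthogonal k l).2 hkl
  intro h0
  have h' := congrArg Matrix.det h
  rw [Matrix.det_mul, h0, zero_mul, Matrix.det_diagonal] at h'
  obtain ⟨k, -, hk⟩ := Finset.prod_eq_zero_iff.1 h'.symm
  exact (intMomentMatrix_orthogonal k k).1 hk rfl

/-- The factors between the moment polynomials and those of the unit lattice. -/
noncomputable def momentWeight (lam : ℝ) : Fin 27 → ℝ :=
  ![1, lam, lam, lam, lam ^ 2, lam ^ 2, lam ^ 2, lam ^ 2, lam ^ 2, lam ^ 2,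
    lam ^ 3, lam ^ 3, lam ^ 3, lam ^ 5 / 2, lam ^ 5 / 2, lam ^ 5 / 2, lam ^ 4 / 2, lam ^ 6 / 2,
    lam ^ 4, lam ^ 4, lam ^ 4, lam ^ 4, lam ^ 4, lam ^ 3, lam ^ 3, lam ^ 3, lam ^ 3]

theorem momentPoly_eq (lam : ℝ) (x y z : ℤ) (k : Fin 27) :
    momentPoly lam ![lam * x, lam * y, lam * z] k =
      momentWeight lam k * (intMomentPoly x y z k : ℝ) := by
  fin_cases k <;> simp [momentPoly, momentWeight, intMomentPoly] <;> ring

/-- Each p_k is homogeneous in (v, λ), so λ only rescales rows and invertibility for every λ ≠ 0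
reduces to one integer matrix. -/
theorem momentMatrix_eq (L : D3Q27) : L.momentMatrix =
    Matrix.diagonal (momentWeight L.lam) * intMomentMatrix.map (Int.castRingHom ℝ) := by
  ext k j
  rw [Matrix.diagonal_mul, momentMatrix, Matrix.of_apply, Matrix.map_apply, intMomentMatrix,
    Matrix.of_apply, eq_intCast, ← momentPoly_eq]
  congr 1
  ext i
  fin_cases i <;> simp [velocity] <;> exact Or.inl (by norm_cast)

theorem isUnit_det_momentMatrix (L : D3Q27) (h : L.lam ≠ 0) : IsUnit L.momentMatrix.det := by
  rw [momentMatrix_eq, Matrix.det_mul, Matrix.det_diagonal, isUnit_iff_ne_zero,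
    ← RingHom.mapMatrix_apply, ← RingHom.map_det]
  refine mul_ne_zero (Finset.prod_ne_zero_iff.2 fun k _ => ?_) ?_
  · fin_cases k <;> simp [momentWeight, h]
  · simpa using det_intMomentMatrix_ne_zero

/-- The moment matrix as a matrix of operators. -/
noncomputable def opM (L : D3Q27) : Matrix (Fin 27) (Fin 27) Op :=
  L.momentMatrix.map MvPolynomial.C

/-- The transport operator `- v_j · ∇`. -/
noncomputable def transport (L : D3Q27) (j : Fin 27) : Op := -∑ i, L.velocity j i • pd i

/-! ### The time step as an exponential -/

theorem opM_mul_inv (L : D3Q27) (h : L.lam ≠ 0) :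
    L.opM * (L.momentMatrix⁻¹).map MvPolynomial.C = 1 := by
  rw [opM, ← Matrix.map_mul, Matrix.mul_nonsing_inv _ (L.isUnit_det_momentMatrix h)]
  exact Matrix.map_one _ (map_zero _) (map_one _)

theorem inv_mul_opM (L : D3Q27) (h : L.lam ≠ 0) :
    (L.momentMatrix⁻¹).map MvPolynomial.C * L.opM = 1 := by
  rw [opM, ← Matrix.map_mul, Matrix.nonsing_inv_mul _ (L.isUnit_det_momentMatrix h)]
  exact Matrix.map_one _ (map_zero _) (map_one _)

theorem propagation_eq (L : D3Q27) (n : ℕ) : L.propagation n =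
    ((n.factorial : ℝ)⁻¹) • (L.opM * Matrix.diagonal (fun j => L.transport j ^ n)
      * (L.momentMatrix⁻¹).map MvPolynomial.C) := by
  have : Matrix.diagonal (fun j => ((n.factorial : ℝ)⁻¹) • (-∑ i, L.velocity j i • pd i) ^ n) =
      ((n.factorial : ℝ)⁻¹) • Matrix.diagonal (fun j => L.transport j ^ n) := by
    rw [← Matrix.diagonal_smul]; rfl
  rw [propagation, this, Matrix.mul_smul, Matrix.smul_mul]; rfl

theorem propagation_one (L : D3Q27) : L.propagation 1 =
    L.opM * Matrix.diagonal L.transport * (L.momentMatrix⁻¹).map MvPolynomial.C := by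
  simp [propagation_eq]

/-- Conjugation by M commutes with taking powers of the diagonal transport matrix. -/
theorem propagation_eq_pow (L : D3Q27) (h : L.lam ≠ 0) (n : ℕ) :
    L.propagation n = ((n.factorial : ℝ)⁻¹) • L.propagation 1 ^ n := by
  rw [propagation_eq, propagation_one]
  congr 1
  induction n with
  | zero => simp [L.opM_mul_inv h]
  | succ n ih =>
    rw [pow_succ, ← ih]
    have : Matrix.diagonal (fun j => L.transport j ^ (n + 1)) =
        Matrix.diagonal (fun j => L.transport j ^ n) * Matrix.diagonal L.transport := by
      rw [Matrix.diagonal_mul_diagonal]; simp [pow_succ]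
    rw [this]
    simp only [Matrix.mul_assoc]
    rw [← Matrix.mul_assoc _ L.opM, L.inv_mul_opM h, Matrix.one_mul]

/-- The matrix `propagation 1` by blocks for `m = (W, Y)`. -/
noncomputable def blockPropagation (L : D3Q27) : Matrix (Fin 4 ⊕ Fin 23) (Fin 4 ⊕ Fin 23) Op :=
  (L.propagation 1).submatrix finSumFinEquiv finSumFinEquiv

theorem isExponential (L : D3Q27) (h : L.lam ≠ 0) :
    IsExponential L.A L.B L.C L.D (L.slaveE.map MvPolynomial.C)
      ((Matrix.diagonal L.slaveS).map MvPolynomial.C)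
      L.blockPropagation.toBlocks₁₁
      L.blockPropagation.toBlocks₁₂
      L.blockPropagation.toBlocks₂₁
      L.blockPropagation.toBlocks₂₂ := by
  intro n
  rw [Matrix.fromBlocks_toBlocks]
  have h1 : Matrix.fromBlocks (L.A n) (L.B n) (L.C n) (L.D n) = L.derivation n :=
    Matrix.fromBlocks_toBlocks _
  have h2 : L.relaxation.map MvPolynomial.C = Matrix.fromBlocks 1 0
      ((Matrix.diagonal L.slaveS).map MvPolynomial.C * L.slaveE.map MvPolynomial.C)
      (1 - (Matrix.diagonal L.slaveS).map (MvPolynomial.C : ℝ →+* Op)) := by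
    rw [relaxation, Matrix.fromBlocks_map, Matrix.map_mul, Matrix.map_sub _ (map_sub _)]
    simp [Matrix.map_one MvPolynomial.C (map_zero _) (map_one _)]
    rfl
  rw [h1, derivation, h2, propagation_eq_pow L h n]
  congr 1
  -- Reindexing is an algebra equivalence, so it commutes with the power and the scalar.
  change ((n.factorial : ℝ)⁻¹) •
      (Matrix.reindexAlgEquiv ℝ Op (finSumFinEquiv (m := 4) (n := 23)).symm)
      (L.propagation 1 ^ n) = ((n.factorial : ℝ)⁻¹) •
      (Matrix.reindexAlgEquiv ℝ Op (finSumFinEquiv (m := 4) (n := 23)).symm) (L.propagation 1) ^ n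
  rw [map_pow]

/-- The matrix `propagation 1` with the derivatives replaced by the wave vector `x`, applied to
the vector of moments `u`. -/
noncomputable def flux (L : D3Q27) (x : Fin 3 → ℝ) (u : Fin 27 → ℝ) (k : Fin 27) : ℝ :=
  ∑ l, MvPolynomial.eval x (L.propagation 1 k l) * u l

/-! ### Rows of the propagation matrix -/

theorem velocity_pow_three (L : D3Q27) (j : Fin 27) (i : Fin 3) :
    L.velocity j i ^ 3 = L.lam ^ 2 * L.velocity j i := by
  have h : (j : ℕ) / 3 ^ (i : ℕ) % 3 < 3 := Nat.mod_lt _ (by norm_num)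
  unfold velocity
  generalize (j : ℕ) / 3 ^ (i : ℕ) % 3 = m at h
  interval_cases m <;> norm_num <;> ring

/-- Since M is invertible, an identity linear in an arbitrary moment vector may be checked for the
moments of a distribution f, that is, velocity by velocity. -/
theorem exists_moments_eq (L : D3Q27) (h : L.lam ≠ 0) (u : Fin 27 → ℝ) :
    ∃ f : Fin 27 → ℝ, u = fun k => ∑ j, f j * momentPoly L.lam (L.velocity j) k := by
  refine ⟨L.momentMatrix⁻¹.mulVec u, ?_⟩
  have : L.momentMatrix.mulVec (L.momentMatrix⁻¹.mulVec u) = u := by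
    rw [Matrix.mulVec_mulVec, Matrix.mul_nonsing_inv _ (L.isUnit_det_momentMatrix h),
      Matrix.one_mulVec]
  conv_lhs => rw [← this]
  ext k
  change ∑ j, L.momentMatrix k j * L.momentMatrix⁻¹.mulVec u j = _
  exact Finset.sum_congr rfl fun j _ => mul_comm _ _

theorem propagation_one_mul_opM (L : D3Q27) (h : L.lam ≠ 0) :
    L.propagation 1 * L.opM = L.opM * Matrix.diagonal L.transport := by
  rw [propagation_one, Matrix.mul_assoc, L.inv_mul_opM h, Matrix.mul_one]

theorem flux_moments (L : D3Q27) (h : L.lam ≠ 0) (x : Fin 3 → ℝ) (f : Fin 27 → ℝ) (k : Fin 27) :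
    L.flux x (fun k => ∑ j, f j * momentPoly L.lam (L.velocity j) k) k =
      ∑ j, f j * (momentPoly L.lam (L.velocity j) k *
        -(L.velocity j 0 * x 0 + L.velocity j 1 * x 1 + L.velocity j 2 * x 2)) := by
  have key (j : Fin 27) : ∑ l, MvPolynomial.eval x (L.propagation 1 k l) *
      momentPoly L.lam (L.velocity j) l = momentPoly L.lam (L.velocity j) k *
        -(L.velocity j 0 * x 0 + L.velocity j 1 * x 1 + L.velocity j 2 * x 2) := by
    have := congrArg (MvPolynomial.eval x) (congrFun (congrFun (L.propagation_one_mul_opM h) k) j)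
    rw [Matrix.mul_apply, Matrix.mul_diagonal] at this
    simpa [ opM, momentMatrix, transport,
      Fin.sum_univ_three, pd, MvPolynomial.smul_eval] using this
  simp only [flux, Finset.mul_sum]
  rw [Finset.sum_comm]
  refine Finset.sum_congr rfl fun j _ => ?_
  rw [← key, Finset.mul_sum]
  exact Finset.sum_congr rfl fun l _ => by ring

/-- In this and the following flux lemmas, the coefficients expand v_i p_k(v) in the moment
polynomials. For density, momentum, energy and q the expansion holds for all real v, so `ring` is
enough. -/
theorem flux_density (L : D3Q27) (h : L.lam ≠ 0) (x : Fin 3 → ℝ) (u : Fin 27 → ℝ) :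
    L.flux x u 0 = -(x 0 * u 1
      + x 1 * u 2
      + x 2 * u 3) := by
  obtain ⟨f, rfl⟩ := L.exists_moments_eq h u
  rw [L.flux_moments h]
  simp only [Finset.mul_sum, ← Finset.sum_add_distrib, ← Finset.sum_neg_distrib]
  refine Finset.sum_congr rfl fun j _ => ?_
  simp [momentPoly]
  ring

theorem flux_momentum_x (L : D3Q27) (h : L.lam ≠ 0) (x : Fin 3 → ℝ) (u : Fin 27 → ℝ) :
    L.flux x u 1 = -(x 0 * (2 / 3 * L.lam ^ 2 * u 0 + 1 / 3 * u 4 + 1 / 3 * u 5)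
      + x 1 * u 7
      + x 2 * u 9) := by
  obtain ⟨f, rfl⟩ := L.exists_moments_eq h u
  rw [L.flux_moments h]
  simp only [Finset.mul_sum, ← Finset.sum_add_distrib, ← Finset.sum_neg_distrib]
  refine Finset.sum_congr rfl fun j _ => ?_
  simp [momentPoly]
  ring

theorem flux_momentum_y (L : D3Q27) (h : L.lam ≠ 0) (x : Fin 3 → ℝ) (u : Fin 27 → ℝ) :
    L.flux x u 2 = -(x 0 * u 7
      + x 1 * (2 / 3 * L.lam ^ 2 * u 0 + 1 / 3 * u 4 - 1 / 6 * u 5 + 1 / 2 * u 6)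
      + x 2 * u 8) := by
  obtain ⟨f, rfl⟩ := L.exists_moments_eq h u
  rw [L.flux_moments h]
  simp only [Finset.mul_sum, ← Finset.sum_add_distrib, ← Finset.sum_sub_distrib,
    ← Finset.sum_neg_distrib]
  refine Finset.sum_congr rfl fun j _ => ?_
  simp [momentPoly]
  ring

theorem flux_momentum_z (L : D3Q27) (h : L.lam ≠ 0) (x : Fin 3 → ℝ) (u : Fin 27 → ℝ) :
    L.flux x u 3 = -(x 0 * u 9
      + x 1 * u 8
      + x 2 * (2 / 3 * L.lam ^ 2 * u 0 + 1 / 3 * u 4 - 1 / 6 * u 5 - 1 / 2 * u 6)) := by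
  obtain ⟨f, rfl⟩ := L.exists_moments_eq h u
  rw [L.flux_moments h]
  simp only [Finset.mul_sum, ← Finset.sum_add_distrib, ← Finset.sum_sub_distrib,
    ← Finset.sum_neg_distrib]
  refine Finset.sum_congr rfl fun j _ => ?_
  simp [momentPoly]
  ring

theorem flux_energy (L : D3Q27) (h : L.lam ≠ 0) (x : Fin 3 → ℝ) (u : Fin 27 → ℝ) :
    L.flux x u 4 = -(x 0 * (1 / 3 * L.lam ^ 2 * u 1 + 1 / 3 * u 10)
      + x 1 * (1 / 3 * L.lam ^ 2 * u 2 + 1 / 3 * u 11)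
      + x 2 * (1 / 3 * L.lam ^ 2 * u 3 + 1 / 3 * u 12)) := by
  obtain ⟨f, rfl⟩ := L.exists_moments_eq h u
  rw [L.flux_moments h]
  simp only [Finset.mul_sum, ← Finset.sum_add_distrib, ← Finset.sum_neg_distrib]
  refine Finset.sum_congr rfl fun j _ => ?_
  simp [momentPoly]
  ring

/-- From here on, except for the q rows, the expansion holds only on the lattice: the multipliers of
`velocity_pow_three` reduce the powers v_i³ to λ²v_i. -/
theorem flux_XX (L : D3Q27) (h : L.lam ≠ 0) (x : Fin 3 → ℝ) (u : Fin 27 → ℝ) :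
    L.flux x u 5 = -(x 0 * (2 / 3 * L.lam ^ 2 * u 1 - 1 / 3 * u 10)
      + x 1 * (-1 / 3 * L.lam ^ 2 * u 2 + 1 / 6 * u 11 - 3 / 2 * u 24)
      + x 2 * (-1 / 3 * L.lam ^ 2 * u 3 + 1 / 6 * u 12 + 3 / 2 * u 25)) := by
  obtain ⟨f, rfl⟩ := L.exists_moments_eq h u
  rw [L.flux_moments h]
  simp only [Finset.mul_sum, ← Finset.sum_add_distrib, ← Finset.sum_sub_distrib,
    ← Finset.sum_neg_distrib]
  refine Finset.sum_congr rfl fun j _ => ?_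
  simp [momentPoly]
  linear_combination -f j * (
    (x 0 * (3)) * L.velocity_pow_three j 0
    + (x 1 * (-(3/2))) * L.velocity_pow_three j 1
    + (x 2 * (-(3/2))) * L.velocity_pow_three j 2)

theorem flux_WW (L : D3Q27) (h : L.lam ≠ 0) (x : Fin 3 → ℝ) (u : Fin 27 → ℝ) :
    L.flux x u 6 = -(x 0 * u 23
      + x 1 * (1 / 3 * L.lam ^ 2 * u 2 - 1 / 6 * u 11 - 1 / 2 * u 24)
      + x 2 * (-1 / 3 * L.lam ^ 2 * u 3 + 1 / 6 * u 12 - 1 / 2 * u 25)) := by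
  obtain ⟨f, rfl⟩ := L.exists_moments_eq h u
  rw [L.flux_moments h]
  simp only [Finset.mul_sum, ← Finset.sum_add_distrib, ← Finset.sum_sub_distrib,
    ← Finset.sum_neg_distrib]
  refine Finset.sum_congr rfl fun j _ => ?_
  simp [momentPoly]
  linear_combination -f j * (
    (x 1 * ((3/2))) * L.velocity_pow_three j 1
    + (x 2 * (-(3/2))) * L.velocity_pow_three j 2)

theorem flux_XY (L : D3Q27) (h : L.lam ≠ 0) (x : Fin 3 → ℝ) (u : Fin 27 → ℝ) :
    L.flux x u 7 = -(x 0 * (2 / 3 * L.lam ^ 2 * u 2 + 1 / 6 * u 11 - 1 / 2 * u 24)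
      + x 1 * (2 / 3 * L.lam ^ 2 * u 1 + 1 / 6 * u 10 + 1 / 2 * u 23)
      + x 2 * u 26) := by
  obtain ⟨f, rfl⟩ := L.exists_moments_eq h u
  rw [L.flux_moments h]
  simp only [Finset.mul_sum, ← Finset.sum_add_distrib, ← Finset.sum_sub_distrib,
    ← Finset.sum_neg_distrib]
  refine Finset.sum_congr rfl fun j _ => ?_
  simp [momentPoly]
  linear_combination -f j * (
    (x 1 * (-(1/2))) * L.velocity_pow_three j 0
    + (x 0 * (-(1/2))) * L.velocity_pow_three j 1)

theorem flux_YZ (L : D3Q27) (h : L.lam ≠ 0) (x : Fin 3 → ℝ) (u : Fin 27 → ℝ) :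
    L.flux x u 8 = -(x 0 * u 26
      + x 1 * (2 / 3 * L.lam ^ 2 * u 3 + 1 / 6 * u 12 - 1 / 2 * u 25)
      + x 2 * (2 / 3 * L.lam ^ 2 * u 2 + 1 / 6 * u 11 + 1 / 2 * u 24)) := by
  obtain ⟨f, rfl⟩ := L.exists_moments_eq h u
  rw [L.flux_moments h]
  simp only [Finset.mul_sum, ← Finset.sum_add_distrib, ← Finset.sum_sub_distrib,
    ← Finset.sum_neg_distrib]
  refine Finset.sum_congr rfl fun j _ => ?_
  simp [momentPoly]
  linear_combination -f j * (
    (x 2 * (-(1/2))) * L.velocity_pow_three j 1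
    + (x 1 * (-(1/2))) * L.velocity_pow_three j 2)

theorem flux_ZX (L : D3Q27) (h : L.lam ≠ 0) (x : Fin 3 → ℝ) (u : Fin 27 → ℝ) :
    L.flux x u 9 = -(x 0 * (2 / 3 * L.lam ^ 2 * u 3 + 1 / 6 * u 12 + 1 / 2 * u 25)
      + x 1 * u 26
      + x 2 * (2 / 3 * L.lam ^ 2 * u 1 + 1 / 6 * u 10 - 1 / 2 * u 23)) := by
  obtain ⟨f, rfl⟩ := L.exists_moments_eq h u
  rw [L.flux_moments h]
  simp only [Finset.mul_sum, ← Finset.sum_add_distrib, ← Finset.sum_sub_distrib,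
    ← Finset.sum_neg_distrib]
  refine Finset.sum_congr rfl fun j _ => ?_
  simp [momentPoly]
  linear_combination -f j * (
    (x 2 * (-(1/2))) * L.velocity_pow_three j 0
    + (x 0 * (-(1/2))) * L.velocity_pow_three j 2)

theorem flux_q_x (L : D3Q27) (h : L.lam ≠ 0) (x : Fin 3 → ℝ) (u : Fin 27 → ℝ) :
    L.flux x u 10 = -(x 0 * (4 / 3 * L.lam ^ 2 * u 4 - 2 / 3 * L.lam ^ 2 * u 5
        + 2 / 3 * u 16 + 1 / 3 * u 18)
      + x 1 * (L.lam ^ 2 * u 7 + u 20)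
      + x 2 * (L.lam ^ 2 * u 9 + u 22)) := by
  obtain ⟨f, rfl⟩ := L.exists_moments_eq h u
  rw [L.flux_moments h]
  simp only [Finset.mul_sum, ← Finset.sum_add_distrib, ← Finset.sum_sub_distrib,
    ← Finset.sum_neg_distrib]
  refine Finset.sum_congr rfl fun j _ => ?_
  simp [momentPoly]
  ring

theorem flux_q_y (L : D3Q27) (h : L.lam ≠ 0) (x : Fin 3 → ℝ) (u : Fin 27 → ℝ) :
    L.flux x u 11 = -(x 0 * (L.lam ^ 2 * u 7 + u 20)
      + x 1 * (4 / 3 * L.lam ^ 2 * u 4 + 1 / 3 * L.lam ^ 2 * u 5 - L.lam ^ 2 * u 6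
        + 2 / 3 * u 16 - 1 / 6 * u 18 + 1 / 2 * u 19)
      + x 2 * (L.lam ^ 2 * u 8 + u 21)) := by
  obtain ⟨f, rfl⟩ := L.exists_moments_eq h u
  rw [L.flux_moments h]
  simp only [Finset.mul_sum, ← Finset.sum_add_distrib, ← Finset.sum_sub_distrib,
    ← Finset.sum_neg_distrib]
  refine Finset.sum_congr rfl fun j _ => ?_
  simp [momentPoly]
  ring

theorem flux_q_z (L : D3Q27) (h : L.lam ≠ 0) (x : Fin 3 → ℝ) (u : Fin 27 → ℝ) :
    L.flux x u 12 = -(x 0 * (L.lam ^ 2 * u 9 + u 22)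
      + x 1 * (L.lam ^ 2 * u 8 + u 21)
      + x 2 * (4 / 3 * L.lam ^ 2 * u 4 + 1 / 3 * L.lam ^ 2 * u 5 + L.lam ^ 2 * u 6
        + 2 / 3 * u 16 - 1 / 6 * u 18 - 1 / 2 * u 19)) := by
  obtain ⟨f, rfl⟩ := L.exists_moments_eq h u
  rw [L.flux_moments h]
  simp only [Finset.mul_sum, ← Finset.sum_add_distrib, ← Finset.sum_sub_distrib,
    ← Finset.sum_neg_distrib]
  refine Finset.sum_congr rfl fun j _ => ?_
  simp [momentPoly]
  ring

theorem flux_antisymm_x (L : D3Q27) (h : L.lam ≠ 0) (x : Fin 3 → ℝ) (u : Fin 27 → ℝ) :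
    L.flux x u 23 = -(x 0 * (2 / 3 * L.lam ^ 2 * u 6 + 1 / 3 * u 19)
      + x 1 * (1 / 3 * L.lam ^ 2 * u 7 - 1 / 3 * u 20)
      + x 2 * (-1 / 3 * L.lam ^ 2 * u 9 + 1 / 3 * u 22)) := by
  obtain ⟨f, rfl⟩ := L.exists_moments_eq h u
  rw [L.flux_moments h]
  simp only [Finset.mul_sum, ← Finset.sum_add_distrib, ← Finset.sum_sub_distrib,
    ← Finset.sum_neg_distrib]
  refine Finset.sum_congr rfl fun j _ => ?_
  simp [momentPoly]
  linear_combination -f j * (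
    (x 1 * (L.velocity j 1) + x 2 * (-L.velocity j 2)) * L.velocity_pow_three j 0
    + (x 0 * (-L.velocity j 1) + x 1 * (2 * L.velocity j 0)) * L.velocity_pow_three j 1
    + (x 0 * (L.velocity j 2) + x 2 * (-2 * L.velocity j 0)) * L.velocity_pow_three j 2)

theorem flux_antisymm_y (L : D3Q27) (h : L.lam ≠ 0) (x : Fin 3 → ℝ) (u : Fin 27 → ℝ) :
    L.flux x u 24 = -(x 0 * (-1 / 3 * L.lam ^ 2 * u 7 + 1 / 3 * u 20)
      + x 1 * (-1 / 3 * L.lam ^ 2 * u 5 - 1 / 3 * L.lam ^ 2 * u 6 - 1 / 6 * u 18 - 1 / 6 * u 19)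
      + x 2 * (1 / 3 * L.lam ^ 2 * u 8 - 1 / 3 * u 21)) := by
  obtain ⟨f, rfl⟩ := L.exists_moments_eq h u
  rw [L.flux_moments h]
  simp only [Finset.mul_sum, ← Finset.sum_add_distrib, ← Finset.sum_sub_distrib,
    ← Finset.sum_neg_distrib]
  refine Finset.sum_congr rfl fun j _ => ?_
  simp [momentPoly]
  linear_combination -f j * (
    (x 0 * (-2 * L.velocity j 1) + x 1 * (L.velocity j 0)) * L.velocity_pow_three j 0
    + (x 0 * (-L.velocity j 0) + x 2 * (L.velocity j 2)) * L.velocity_pow_three j 1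
    + (x 1 * (-L.velocity j 2) + x 2 * (2 * L.velocity j 1)) * L.velocity_pow_three j 2)

theorem flux_antisymm_z (L : D3Q27) (h : L.lam ≠ 0) (x : Fin 3 → ℝ) (u : Fin 27 → ℝ) :
    L.flux x u 25 = -(x 0 * (1 / 3 * L.lam ^ 2 * u 9 - 1 / 3 * u 22)
      + x 1 * (-1 / 3 * L.lam ^ 2 * u 8 + 1 / 3 * u 21)
      + x 2 * (1 / 3 * L.lam ^ 2 * u 5 - 1 / 3 * L.lam ^ 2 * u 6 + 1 / 6 * u 18 - 1 / 6 * u 19)) := by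
  obtain ⟨f, rfl⟩ := L.exists_moments_eq h u
  rw [L.flux_moments h]
  simp only [Finset.mul_sum, ← Finset.sum_add_distrib, ← Finset.sum_sub_distrib,
    ← Finset.sum_neg_distrib]
  refine Finset.sum_congr rfl fun j _ => ?_
  simp [momentPoly]
  linear_combination -f j * (
    (x 0 * (2 * L.velocity j 2) + x 2 * (-L.velocity j 0)) * L.velocity_pow_three j 0
    + (x 1 * (-2 * L.velocity j 2) + x 2 * (L.velocity j 1)) * L.velocity_pow_three j 1
    + (x 0 * (L.velocity j 0) + x 1 * (-L.velocity j 1)) * L.velocity_pow_three j 2)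

theorem flux_XYZ (L : D3Q27) (h : L.lam ≠ 0) (x : Fin 3 → ℝ) (u : Fin 27 → ℝ) :
    L.flux x u 26 = -(x 0 * (2 / 3 * L.lam ^ 2 * u 8 + 1 / 3 * u 21)
      + x 1 * (2 / 3 * L.lam ^ 2 * u 9 + 1 / 3 * u 22)
      + x 2 * (2 / 3 * L.lam ^ 2 * u 7 + 1 / 3 * u 20)) := by
  obtain ⟨f, rfl⟩ := L.exists_moments_eq h u
  rw [L.flux_moments h]
  simp only [Finset.mul_sum, ← Finset.sum_add_distrib, ← Finset.sum_neg_distrib]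
  refine Finset.sum_congr rfl fun j _ => ?_
  simp [momentPoly]
  linear_combination -f j * (
    (x 1 * (-L.velocity j 2) + x 2 * (-L.velocity j 1)) * L.velocity_pow_three j 0
    + (x 0 * (-L.velocity j 2) + x 2 * (-L.velocity j 0)) * L.velocity_pow_three j 1
    + (x 0 * (-L.velocity j 1) + x 1 * (-L.velocity j 0)) * L.velocity_pow_three j 2)

/-- The moments at equilibrium when the `j`-th conserved moment is `1` and the other ones
vanish. -/
def equil (L : D3Q27) (j : Fin 4) (l : Fin 27) : ℝ :=
  if (l : ℕ) < 4 then (if (l : ℕ) = (j : ℕ) then 1 else 0) else L.E l j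

/-- The operator `α₁` at the wave vector `x`. -/
noncomputable def alphaOne (L : D3Q27) (x : Fin 3 → ℝ) (i j : Fin 4) : ℝ :=
  L.flux x (L.equil j) (Fin.castAdd 23 i)

/-- The defect of conservation at the wave vector `x`, extended by zero to the conserved
moments. -/
noncomputable def defectOne (L : D3Q27) (x : Fin 3 → ℝ) (j : Fin 4) (l : Fin 27) : ℝ :=
  if (l : ℕ) < 4 then 0 else L.flux x (L.equil j) l - ∑ i, L.E l i * L.alphaOne x i j

/-- The operator `α₂` at the wave vector `x`. -/
noncomputable def alphaTwo (L : D3Q27) (x : Fin 3 → ℝ) (i j : Fin 4) : ℝ :=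
  L.flux x (fun l => L.sigma l * L.defectOne x j l) (Fin.castAdd 23 i)

/-- The defect of conservation at second order. -/
noncomputable def defectTwo (L : D3Q27) (x : Fin 3 → ℝ) (j : Fin 4) (l : Fin 27) : ℝ :=
  if (l : ℕ) < 4 then 0 else L.flux x (fun l => L.sigma l * L.defectOne x j l) l
    - ∑ i, L.sigma l * L.defectOne x i l * L.alphaOne x i j - ∑ i, L.E l i * L.alphaTwo x i j

/-- The operator `α₃` at the wave vector `x`. -/
noncomputable def alphaThree (L : D3Q27) (x : Fin 3 → ℝ) (i j : Fin 4) : ℝ :=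
  L.flux x (fun l => L.sigma l * L.defectTwo x j l) (Fin.castAdd 23 i)
    - 1 / 12 * L.flux x (L.flux x (L.defectOne x j)) (Fin.castAdd 23 i)
    + 1 / 6 * L.flux x (fun l => ∑ i, L.defectOne x i l * L.alphaOne x i j) (Fin.castAdd 23 i)

/-! ### Evaluation of the operators at a wave vector -/

/-- The vector `u` stacks a column of X over one of Y, so that block products become a single flux.
Together with `eval_bottom` this transfers the operator formulas to real numbers. -/
theorem eval_top (L : D3Q27) (x : Fin 3 → ℝ) (X : Matrix (Fin 4) (Fin 4) Op)
    (Y : Matrix (Fin 23) (Fin 4) Op) (i j : Fin 4) (u : Fin 27 → ℝ)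
    (hX : ∀ k, u (Fin.castAdd 23 k) = MvPolynomial.eval x (X k j))
    (hY : ∀ l, u (Fin.natAdd 4 l) = MvPolynomial.eval x (Y l j)) :
    MvPolynomial.eval x ((L.blockPropagation.toBlocks₁₁ * X
        + L.blockPropagation.toBlocks₁₂ * Y) i j) =
      L.flux x u (Fin.castAdd 23 i) := by
  rw [flux, Fin.sum_univ_add (a := 4) (b := 23)]
  simp [Matrix.mul_apply, hX, hY, blockPropagation, Matrix.toBlocks₁₁, Matrix.toBlocks₁₂]
  rfl

theorem eval_bottom (L : D3Q27) (x : Fin 3 → ℝ) (X : Matrix (Fin 4) (Fin 4) Op)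
    (Y : Matrix (Fin 23) (Fin 4) Op) (i : Fin 23) (j : Fin 4) (u : Fin 27 → ℝ)
    (hX : ∀ k, u (Fin.castAdd 23 k) = MvPolynomial.eval x (X k j))
    (hY : ∀ l, u (Fin.natAdd 4 l) = MvPolynomial.eval x (Y l j)) :
    MvPolynomial.eval x ((L.blockPropagation.toBlocks₂₁ * X
        + L.blockPropagation.toBlocks₂₂ * Y) i j) =
      L.flux x u (Fin.natAdd 4 i) := by
  rw [flux, Fin.sum_univ_add (a := 4) (b := 23)]
  simp [Matrix.mul_apply, hX, hY, blockPropagation, Matrix.toBlocks₂₁, Matrix.toBlocks₂₂]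
  rfl

theorem equil_castAdd (L : D3Q27) (j k : Fin 4) :
    L.equil j (Fin.castAdd 23 k) = if k = j then 1 else 0 := by
  simp [equil, Fin.ext_iff]

theorem equil_natAdd (L : D3Q27) (j : Fin 4) (l : Fin 23) :
    L.equil j (Fin.natAdd 4 l) = L.slaveE l j := by
  simp [equil, slaveE]

/-- The equilibrium matrix as a matrix of operators. -/
noncomputable def opE (L : D3Q27) : Matrix (Fin 23) (Fin 4) Op := L.slaveE.map MvPolynomial.C

theorem eval_opE (L : D3Q27) (x : Fin 3 → ℝ) (l : Fin 23) (j : Fin 4) :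
    MvPolynomial.eval x (L.opE l j) = L.E (Fin.natAdd 4 l) j := by
  simp [opE, slaveE]

/-- The operator `α₁` in terms of the blocks of `propagation 1`. -/
noncomputable def opAlphaOne (L : D3Q27) : Matrix (Fin 4) (Fin 4) Op :=
  L.blockPropagation.toBlocks₁₁ + L.blockPropagation.toBlocks₁₂ * L.opE

/-- The defect of conservation of the scheme. -/
noncomputable def opDefect (L : D3Q27) : Matrix (Fin 23) (Fin 4) Op :=
  defect L.blockPropagation.toBlocks₁₁ L.blockPropagation.toBlocks₁₂
    L.blockPropagation.toBlocks₂₁ L.blockPropagation.toBlocks₂₂ (L.opE)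

/-- Hénon's parameters as a diagonal matrix of operators. -/
noncomputable def opSigma (L : D3Q27) : Matrix (Fin 23) (Fin 23) Op :=
  (Matrix.diagonal fun l => MvPolynomial.C (1 / L.slaveS l)) - (1 / 2 : ℝ) • 1

theorem opSigma_mul_apply (L : D3Q27) (x : Fin 3 → ℝ) (X : Matrix (Fin 23) (Fin 4) Op)
    (l : Fin 23) (j : Fin 4) : MvPolynomial.eval x ((L.opSigma * X) l j) =
      L.sigma (Fin.natAdd 4 l) * MvPolynomial.eval x (X l j) := by
  simp [opSigma, Matrix.sub_mul, Matrix.diagonal_mul, sigma, slaveS, MvPolynomial.smul_eval]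
  ring

theorem alpha_one_eq (L : D3Q27) (h : L.lam ≠ 0) : L.alpha 1 = L.opAlphaOne := by
  rw [alpha, (L.isExponential h).expansion_one]; rfl

theorem slaveS_mul_inv (L : D3Q27) (hs : ∀ k : Fin 27, 4 ≤ k → 0 < L.s k) :
    (Matrix.diagonal L.slaveS).map (MvPolynomial.C : ℝ →+* Op) *
      Matrix.diagonal (fun l => MvPolynomial.C (1 / L.slaveS l)) = 1 := by
  rw [Matrix.diagonal_map (map_zero _), Matrix.diagonal_mul_diagonal, ← Matrix.diagonal_one]
  congr 1
  ext1 l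
  have hl : L.slaveS l ≠ 0 := (hs (Fin.natAdd 4 l) (by simp [Fin.le_def])).ne'
  rw [← map_mul, mul_one_div_cancel hl, map_one]

theorem alpha_two_eq (L : D3Q27) (h : L.lam ≠ 0) (hs : ∀ k : Fin 27, 4 ≤ k → 0 < L.s k) :
    L.alpha 2 = L.blockPropagation.toBlocks₁₂ * (L.opSigma * L.opDefect) := by
  rw [alpha, (L.isExponential h).expansion_two (L.slaveS_mul_inv hs)]; rfl

theorem alpha_three_eq (L : D3Q27) (h : L.lam ≠ 0) (hs : ∀ k : Fin 27, 4 ≤ k → 0 < L.s k) :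
    L.alpha 3 = L.blockPropagation.toBlocks₁₂ * (L.opSigma *
        (L.blockPropagation.toBlocks₂₂ * (L.opSigma * L.opDefect)
          - L.opSigma * L.opDefect * L.alpha 1 - L.opE * L.alpha 2))
      - (1 / 12 : ℝ) • (L.blockPropagation.toBlocks₁₁ *
          (L.blockPropagation.toBlocks₁₂ * L.opDefect)
        + L.blockPropagation.toBlocks₁₂ * (L.blockPropagation.toBlocks₂₂ * L.opDefect))
      + (1 / 6 : ℝ) • (L.blockPropagation.toBlocks₁₂ * (L.opDefect * L.alpha 1)) := by
  rw [alpha]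
  exact (L.isExponential h).expansion_three (L.slaveS_mul_inv hs) _ _ _ _
    (L.alpha_one_eq h) rfl rfl (L.alpha_two_eq h hs)

theorem eval_alpha_one (L : D3Q27) (h : L.lam ≠ 0) (x : Fin 3 → ℝ) (i j : Fin 4) :
    MvPolynomial.eval x (L.alpha 1 i j) = L.alphaOne x i j := by
  rw [L.alpha_one_eq h, alphaOne, ← L.eval_top x 1 (L.opE) i j (L.equil j),
    Matrix.mul_one]
  · rfl
  · intro k
    rw [equil_castAdd, Matrix.one_apply]
    split_ifs <;> simp
  · intro l
    rw [equil_natAdd, eval_opE]; rfl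

theorem eval_top_zero (L : D3Q27) (x : Fin 3 → ℝ)
    (Y : Matrix (Fin 23) (Fin 4) Op) (i j : Fin 4) (u : Fin 27 → ℝ)
    (hX : ∀ k : Fin 4, u (Fin.castAdd 23 k) = 0)
    (hY : ∀ l, u (Fin.natAdd 4 l) = MvPolynomial.eval x (Y l j)) :
    MvPolynomial.eval x ((L.blockPropagation.toBlocks₁₂ * Y) i j) =
      L.flux x u (Fin.castAdd 23 i) := by
  rw [← L.eval_top x 0 Y i j u (by simpa using hX) hY, Matrix.mul_zero, zero_add]

theorem eval_bottom_zero (L : D3Q27) (x : Fin 3 → ℝ)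
    (Y : Matrix (Fin 23) (Fin 4) Op) (i : Fin 23) (j : Fin 4) (u : Fin 27 → ℝ)
    (hX : ∀ k : Fin 4, u (Fin.castAdd 23 k) = 0)
    (hY : ∀ l, u (Fin.natAdd 4 l) = MvPolynomial.eval x (Y l j)) :
    MvPolynomial.eval x ((L.blockPropagation.toBlocks₂₂ * Y) i j) =
      L.flux x u (Fin.natAdd 4 i) := by
  rw [← L.eval_bottom x 0 Y i j u (by simpa using hX) hY, Matrix.mul_zero, zero_add]

theorem defectOne_castAdd (L : D3Q27) (x : Fin 3 → ℝ) (j k : Fin 4) :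
    L.defectOne x j (Fin.castAdd 23 k) = 0 := by
  simp [defectOne]

theorem eval_opDefect (L : D3Q27) (h : L.lam ≠ 0) (x : Fin 3 → ℝ) (l : Fin 23) (j : Fin 4) :
    L.defectOne x j (Fin.natAdd 4 l) = MvPolynomial.eval x (L.opDefect l j) := by
  have e : L.opDefect = L.blockPropagation.toBlocks₂₁ * (1 : Matrix (Fin 4) (Fin 4) Op)
      + L.blockPropagation.toBlocks₂₂ * L.opE
      - L.opE * L.alpha 1 := by
    rw [Matrix.mul_one, L.alpha_one_eq h]; rfl
  rw [e, Matrix.sub_apply, map_sub, L.eval_bottom x 1 _ l j (L.equil j)]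
  · simp [defectOne, Matrix.mul_apply, L.eval_alpha_one h, eval_opE]
  · intro k
    rw [equil_castAdd, Matrix.one_apply]
    split_ifs <;> simp
  · intro l
    rw [equil_natAdd, eval_opE]; rfl

theorem eval_alpha_two (L : D3Q27) (h : L.lam ≠ 0) (hs : ∀ k : Fin 27, 4 ≤ k → 0 < L.s k)
    (x : Fin 3 → ℝ) (i j : Fin 4) :
    MvPolynomial.eval x (L.alpha 2 i j) = L.alphaTwo x i j := by
  rw [L.alpha_two_eq h hs, alphaTwo]
  apply L.eval_top_zero
  · intro k
    rw [defectOne_castAdd, mul_zero]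
  · intro l
    rw [opSigma_mul_apply, L.eval_opDefect h]

theorem eval_alpha_three (L : D3Q27) (h : L.lam ≠ 0) (hs : ∀ k : Fin 27, 4 ≤ k → 0 < L.s k)
    (x : Fin 3 → ℝ) (i j : Fin 4) :
    MvPolynomial.eval x (L.alpha 3 i j) = L.alphaThree x i j := by
  rw [L.alpha_three_eq h hs, alphaThree, Matrix.add_apply, Matrix.sub_apply, map_add, map_sub,
    Matrix.smul_apply, Matrix.smul_apply, MvPolynomial.smul_eval, MvPolynomial.smul_eval]
  congr 1
  · congr 1
    · apply L.eval_top_zero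
      · intro k
        simp [defectTwo]
      · intro l
        rw [opSigma_mul_apply, Matrix.sub_apply, Matrix.sub_apply, map_sub, map_sub,
          L.eval_bottom_zero x _ l j (fun l => L.sigma l * L.defectOne x j l)]
        · simp only [Matrix.mul_apply (M := L.opSigma * L.opDefect),
            Matrix.mul_apply (M := L.opE), map_sum, map_mul,
            eval_opE, opSigma_mul_apply, L.eval_alpha_one h, L.eval_alpha_two h hs, ← L.eval_opDefect h]
          simp [defectTwo]
        · intro k
          rw [defectOne_castAdd, mul_zero]
        · intro l
          rw [opSigma_mul_apply, L.eval_opDefect h]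
    · congr 1
      -- The sum abΨ + bdΨ is the upper block of Λ² applied to (0, Ψ), hence an iterated flux.
      apply L.eval_top
      · intro k
        exact (L.eval_top_zero x _ k j _ (L.defectOne_castAdd x j)
          fun l => L.eval_opDefect h x l j).symm
      · intro l
        exact (L.eval_bottom_zero x _ l j _ (L.defectOne_castAdd x j)
          fun l => L.eval_opDefect h x l j).symm
  · congr 1
    apply L.eval_top_zero
    · intro k
      simp [defectOne_castAdd]
    · intro l
      simp [Matrix.mul_apply, L.eval_alpha_one h, L.eval_opDefect h]

end D3Q27

/-! ### The isotropic acoustic system and its symbol -/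

section BlockOp

variable (a : Op) (b c : Fin 3 → Op) (d : Matrix (Fin 3) (Fin 3) Op) (i j : Fin 3)

theorem blockOp_zero_zero : blockOp a b c d 0 0 = a := rfl

theorem blockOp_zero_succ : blockOp a b c d 0 j.succ = b j := rfl

theorem blockOp_succ_zero : blockOp a b c d i.succ 0 = c i := rfl

theorem blockOp_succ_succ : blockOp a b c d i.succ j.succ = d i j := rfl

end BlockOp

theorem acousticOp_isRotationInvariant (c2 μ ζ ξ χ : ℝ) :
    IsRotationInvariant (acousticOp c2 μ ζ ξ χ) := by
  -- The index k counts Laplacians: c₀² and -ζ sit at k = 0, while ξ, χ and -μ sit at k = 1.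
  refine ⟨2, fun _ => 0, ![1, ξ] ∘ Fin.ofNat 2, ![c2, χ] ∘ Fin.ofNat 2, ![0, -μ] ∘ Fin.ofNat 2,
    ![-ζ, 0] ∘ Fin.ofNat 2, fun _ => 0, ?_⟩
  ext1 i j
  refine Fin.cases ?_ (fun i => ?_) i <;> refine Fin.cases ?_ (fun j => ?_) j
  · simp [acousticOp, blockOp, Finset.sum_range_succ]
  · simp [acousticOp, blockOp, Finset.sum_range_succ, mul_comm]
  · simp [acousticOp, blockOp, Finset.sum_range_succ]
  · simp [acousticOp, blockOp, Finset.sum_range_succ]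
    split_ifs <;> simp [sub_eq_add_neg, add_comm]

/-- The symbol of the isotropic acoustic system at the wave vector `x`. -/
noncomputable def acousticSymbol (c2 μ ζ ξ χ : ℝ) (x : Fin 3 → ℝ) : Matrix (Fin 4) (Fin 4) ℝ :=
  let n := x 0 ^ 2 + x 1 ^ 2 + x 2 ^ 2
  !![0, x 0 + ξ * (n * x 0), x 1 + ξ * (n * x 1), x 2 + ξ * (n * x 2);
    c2 * x 0 + χ * (x 0 * n), -(μ * n) - ζ * (x 0 * x 0), -(ζ * (x 0 * x 1)), -(ζ * (x 0 * x 2));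
    c2 * x 1 + χ * (x 1 * n), -(ζ * (x 1 * x 0)), -(μ * n) - ζ * (x 1 * x 1), -(ζ * (x 1 * x 2));
    c2 * x 2 + χ * (x 2 * n), -(ζ * (x 2 * x 0)), -(ζ * (x 2 * x 1)), -(μ * n) - ζ * (x 2 * x 2)]

theorem eval_acousticOp (c2 μ ζ ξ χ : ℝ) (x : Fin 3 → ℝ) (i j : Fin 4) :
    MvPolynomial.eval x (acousticOp c2 μ ζ ξ χ i j) = acousticSymbol c2 μ ζ ξ χ x i j := by
  refine Fin.cases ?_ (fun i => ?_) i <;> refine Fin.cases ?_ (fun j => ?_) j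
  · simp [acousticOp, blockOp_zero_zero, acousticSymbol]
  · rw [acousticOp, blockOp_zero_succ]
    fin_cases j <;> simp [acousticSymbol, lap, pd, Fin.sum_univ_three, MvPolynomial.smul_eval]
  · rw [acousticOp, blockOp_succ_zero]
    fin_cases i <;> simp [acousticSymbol, lap, pd, Fin.sum_univ_three, MvPolynomial.smul_eval]
  · rw [acousticOp, blockOp_succ_succ]
    fin_cases i <;> fin_cases j <;>
      simp [acousticSymbol, lap, pd, Fin.sum_univ_three, MvPolynomial.smul_eval] <;> ring

namespace D3Q27

theorem eval_equivOp_one (L : D3Q27) (h : L.lam ≠ 0) (x : Fin 3 → ℝ) (i j : Fin 4) :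
    MvPolynomial.eval x (L.equivOp 1 i j) = -L.alphaOne x i j := by
  simp [equivOp, L.eval_alpha_one h]

theorem eval_equivOp_two (L : D3Q27) (h : L.lam ≠ 0) (hs : ∀ k : Fin 27, 4 ≤ k → 0 < L.s k)
    (x : Fin 3 → ℝ) (i j : Fin 4) :
    MvPolynomial.eval x (L.equivOp 2 i j) = -(L.alphaOne x i j + L.dt * L.alphaTwo x i j) := by
  simp [equivOp, L.eval_alpha_one h, L.eval_alpha_two h hs, Finset.sum_Icc_succ_top,
    MvPolynomial.smul_eval]

theorem eval_equivOp_three (L : D3Q27) (h : L.lam ≠ 0) (hs : ∀ k : Fin 27, 4 ≤ k → 0 < L.s k)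
    (x : Fin 3 → ℝ) (i j : Fin 4) :
    MvPolynomial.eval x (L.equivOp 3 i j) =
      -(L.alphaOne x i j + L.dt * L.alphaTwo x i j + L.dt ^ 2 * L.alphaThree x i j) := by
  simp [equivOp, L.eval_alpha_one h, L.eval_alpha_two h hs, L.eval_alpha_three h hs,
    Finset.sum_Icc_succ_top, MvPolynomial.smul_eval]

theorem castAdd_zero : Fin.castAdd 23 (0 : Fin 4) = (0 : Fin 27) := rfl
theorem castAdd_one : Fin.castAdd 23 (1 : Fin 4) = (1 : Fin 27) := rfl
theorem castAdd_two : Fin.castAdd 23 (2 : Fin 4) = (2 : Fin 27) := rfl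
theorem castAdd_three : Fin.castAdd 23 (3 : Fin 4) = (3 : Fin 27) := rfl

/-! ### First order system and first defects of conservation -/

section Equilibrium

variable {L : D3Q27} {α κ β : ℝ}

theorem alphaOne_eq (h : L.lam ≠ 0) (hE : L.FirstOrderEquilibrium α) (x : Fin 3 → ℝ) :
    L.alphaOne x = !![0, -x 0, -x 1, -x 2;
      -((α + 2) / 3 * L.lam ^ 2 * x 0), 0, 0, 0;
      -((α + 2) / 3 * L.lam ^ 2 * x 1), 0, 0, 0;
      -((α + 2) / 3 * L.lam ^ 2 * x 2), 0, 0, 0] := by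
  obtain ⟨h4, h5, h6, h7, h8, h9⟩ := hE
  ext i j
  fin_cases i <;> fin_cases j <;>
  simp [alphaOne, castAdd_zero, castAdd_one, castAdd_two, castAdd_three, L.flux_density h,
    L.flux_momentum_x h, L.flux_momentum_y h, L.flux_momentum_z h, equil, h4, h5, h6, h7, h8, h9]
  all_goals ring

theorem equivOp_one_eq (h : L.lam ≠ 0) (hE : L.FirstOrderEquilibrium α) :
    L.equivOp 1 = acousticOp ((α + 2) / 3 * L.lam ^ 2) 0 0 0 0 := by
  ext1 i j
  -- Real polynomials are determined by their values, so the symbols can be compared entrywise.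
  refine MvPolynomial.funext fun x => ?_
  rw [eval_acousticOp, L.eval_equivOp_one h, alphaOne_eq h hE]
  fin_cases i <;> fin_cases j <;> simp [acousticSymbol]

theorem defectOne_conserved (x : Fin 3 → ℝ) (j : Fin 4) (l : Fin 27) (hl : (l : ℕ) < 4) :
    L.defectOne x j l = 0 := by
  simp [defectOne, hl]

theorem defectOne_energy (h : L.lam ≠ 0) (hE : L.FirstOrderEquilibrium α)
    (hQ : L.HeatFluxEquilibrium κ) (x : Fin 3 → ℝ)
    (j : Fin 4) : L.defectOne x j 4 = (![0, (α - (1 + κ) / 3) * L.lam ^ 2 * x 0,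
      (α - (1 + κ) / 3) * L.lam ^ 2 * x 1, (α - (1 + κ) / 3) * L.lam ^ 2 * x 2] : Fin 4 → ℝ) j := by
  obtain ⟨h10, h11, h12⟩ := hQ
  fin_cases j <;>
  simp [defectOne, alphaOne_eq h hE, L.flux_energy h, equil, hE.1, h10, h11, h12,
    Fin.sum_univ_four]
  all_goals ring

theorem defectOne_XX (h : L.lam ≠ 0) (hE : L.FirstOrderEquilibrium α)
    (hQ : L.HeatFluxEquilibrium κ) (hN : L.NullThirdOrderEquilibrium) (x : Fin 3 → ℝ)
    (j : Fin 4) : L.defectOne x j 5 = (![0, (κ - 2) / 3 * L.lam ^ 2 * x 0,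
      (2 - κ) / 6 * L.lam ^ 2 * x 1, (2 - κ) / 6 * L.lam ^ 2 * x 2] : Fin 4 → ℝ) j := by
  obtain ⟨h10, h11, h12⟩ := hQ
  obtain ⟨h23, h24, h25, h26⟩ := hN
  fin_cases j <;>
  simp [defectOne, L.flux_XX h, equil, hE.2.1, h10, h11, h12, h24, h25]
  all_goals ring

theorem defectOne_WW (h : L.lam ≠ 0) (hE : L.FirstOrderEquilibrium α)
    (hQ : L.HeatFluxEquilibrium κ) (hN : L.NullThirdOrderEquilibrium) (x : Fin 3 → ℝ)
    (j : Fin 4) : L.defectOne x j 6 = (![0, 0, (κ - 2) / 6 * L.lam ^ 2 * x 1,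
        (2 - κ) / 6 * L.lam ^ 2 * x 2] : Fin 4 → ℝ) j := by
  obtain ⟨h10, h11, h12⟩ := hQ
  obtain ⟨h23, h24, h25, h26⟩ := hN
  fin_cases j <;>
  simp [defectOne, L.flux_WW h, equil, hE.2.2.1, h11, h12, h23, h24, h25]
  all_goals ring

theorem defectOne_XY (h : L.lam ≠ 0) (hE : L.FirstOrderEquilibrium α)
    (hQ : L.HeatFluxEquilibrium κ) (hN : L.NullThirdOrderEquilibrium) (x : Fin 3 → ℝ)
    (j : Fin 4) : L.defectOne x j 7 = (![0, -((4 + κ) / 6 * L.lam ^ 2 * x 1),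
      -((4 + κ) / 6 * L.lam ^ 2 * x 0), 0] : Fin 4 → ℝ) j := by
  obtain ⟨h10, h11, h12⟩ := hQ
  obtain ⟨h23, h24, h25, h26⟩ := hN
  fin_cases j <;>
  simp [defectOne, L.flux_XY h, equil, hE.2.2.2.1, h10, h11, h23, h24, h26]
  all_goals ring

theorem defectOne_YZ (h : L.lam ≠ 0) (hE : L.FirstOrderEquilibrium α)
    (hQ : L.HeatFluxEquilibrium κ) (hN : L.NullThirdOrderEquilibrium) (x : Fin 3 → ℝ)
    (j : Fin 4) : L.defectOne x j 8 = (![0, 0, -((4 + κ) / 6 * L.lam ^ 2 * x 2),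
      -((4 + κ) / 6 * L.lam ^ 2 * x 1)] : Fin 4 → ℝ) j := by
  obtain ⟨h10, h11, h12⟩ := hQ
  obtain ⟨h23, h24, h25, h26⟩ := hN
  fin_cases j <;>
  simp [defectOne, L.flux_YZ h, equil, hE.2.2.2.2.1, h11, h12, h24, h25, h26]
  all_goals ring

theorem defectOne_ZX (h : L.lam ≠ 0) (hE : L.FirstOrderEquilibrium α)
    (hQ : L.HeatFluxEquilibrium κ) (hN : L.NullThirdOrderEquilibrium) (x : Fin 3 → ℝ)
    (j : Fin 4) : L.defectOne x j 9 = (![0, -((4 + κ) / 6 * L.lam ^ 2 * x 2), 0,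
      -((4 + κ) / 6 * L.lam ^ 2 * x 0)] : Fin 4 → ℝ) j := by
  obtain ⟨h10, h11, h12⟩ := hQ
  obtain ⟨h23, h24, h25, h26⟩ := hN
  fin_cases j <;>
  simp [defectOne, L.flux_ZX h, equil, hE.2.2.2.2.2, h10, h12, h23, h25, h26]
  all_goals ring

end Equilibrium
-- Isotropy at second and third order
section Isotropic

variable {L : D3Q27} {α κ β δ : ℝ}

/-- The density row of α₂ vanishes because the mass flux is exactly the momentum; the added matrix
cancels the div J row built into `acousticSymbol`. The hypothesis `hκ` says (2 - κ)σ₅ = 2(4 + κ)σ₇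
and is needed on the momentum diagonal, where the coefficient of x_i² must be μ + ζ. -/
theorem alphaTwo_eq (h : L.lam ≠ 0) (hE : L.FirstOrderEquilibrium α)
    (hQ : L.HeatFluxEquilibrium κ) (hN : L.NullThirdOrderEquilibrium)
    (hσ : L.SecondOrderRelaxation) (hκ : κ * (L.sigma 5 + 2 * L.sigma 7) =
      2 * (L.sigma 5 - 4 * L.sigma 7)) (x : Fin 3 → ℝ) :
    L.alphaTwo x = -acousticSymbol 0 ((4 + κ) / 6 * L.sigma 7 * L.lam ^ 2)
      (((4 + κ) / 6 * L.sigma 7 - L.sigma 4 * (α - (1 + κ) / 3) / 3 - L.sigma 5 * (2 - κ) / 18)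
        * L.lam ^ 2) 0 0 x + !![0, x 0, x 1, x 2; 0, 0, 0, 0; 0, 0, 0, 0; 0, 0, 0, 0] := by
  obtain ⟨h6, h8, h9⟩ := hσ
  rw [eq_comm] at h6 h8 h9
  rw [h8] at h9
  have hc := fun j l => L.defectOne_conserved x j l
  have d4 := defectOne_energy h hE hQ x
  have d5 := defectOne_XX h hE hQ hN x
  have d6 := defectOne_WW h hE hQ hN x
  have d7 := defectOne_XY h hE hQ hN x
  have d8 := defectOne_YZ h hE hQ hN x
  have d9 := defectOne_ZX h hE hQ hN x
  ext i j
  fin_cases i <;> fin_cases j <;>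
  simp [alphaTwo, castAdd_zero, castAdd_one, castAdd_two, castAdd_three, L.flux_density h,
    L.flux_momentum_x h, L.flux_momentum_y h, L.flux_momentum_z h, hc, d4, d5, d6, d7, d8, d9,
    acousticSymbol, h6, h8, h9]
  · linear_combination (-(1 / 6) * L.lam ^ 2 * x 0 ^ 2) * hκ
  · ring
  · ring
  · ring
  · linear_combination (-(1 / 6) * L.lam ^ 2 * x 1 ^ 2) * hκ
  · ring
  · ring
  · ring
  · linear_combination (-(1 / 6) * L.lam ^ 2 * x 2 ^ 2) * hκ

theorem equivOp_two_eq (h : L.lam ≠ 0) (hs : ∀ k : Fin 27, 4 ≤ k → 0 < L.s k)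
    (hE : L.FirstOrderEquilibrium α)
    (hQ : L.HeatFluxEquilibrium κ) (hN : L.NullThirdOrderEquilibrium)
    (hσ : L.SecondOrderRelaxation) (hκ : κ * (L.sigma 5 + 2 * L.sigma 7) =
      2 * (L.sigma 5 - 4 * L.sigma 7)) :
    L.equivOp 2 = acousticOp ((α + 2) / 3 * L.lam ^ 2)
      (L.dt * ((4 + κ) / 6 * L.sigma 7 * L.lam ^ 2))
      (L.dt * (((4 + κ) / 6 * L.sigma 7 - L.sigma 4 * (α - (1 + κ) / 3) / 3
        - L.sigma 5 * (2 - κ) / 18) * L.lam ^ 2)) 0 0 := by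
  ext1 i j
  refine MvPolynomial.funext fun x => ?_
  rw [eval_acousticOp, L.eval_equivOp_two h hs, alphaOne_eq h hE, alphaTwo_eq h hE hQ hN hσ hκ]
  fin_cases i <;> fin_cases j <;> simp [acousticSymbol] <;> ring

theorem defectOne_q_x (h : L.lam ≠ 0) (hE : L.FirstOrderEquilibrium α)
    (hQ : L.HeatFluxEquilibrium (-2)) (hF : L.FourthDegreeEquilibrium β) (x : Fin 3 → ℝ)
    (j : Fin 4) : L.defectOne x j 10 =
      (![-(2 / 3 * (3 * α + 2 + β) * L.lam ^ 4 * x 0), 0, 0, 0] : Fin 4 → ℝ) j := by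
  obtain ⟨h4, h5, h6, h7, h8, h9⟩ := hE
  obtain ⟨h16, h18, h19, h20, h21, h22⟩ := hF
  fin_cases j <;>
  simp [defectOne, alphaOne_eq h ⟨h4, h5, h6, h7, h8, h9⟩, L.flux_q_x h, equil, hQ.1, h4, h5, h7,
    h9, h16, h18, h20, h22, Fin.sum_univ_four]
  ring

theorem defectOne_q_y (h : L.lam ≠ 0) (hE : L.FirstOrderEquilibrium α)
    (hQ : L.HeatFluxEquilibrium (-2)) (hF : L.FourthDegreeEquilibrium β) (x : Fin 3 → ℝ)
    (j : Fin 4) : L.defectOne x j 11 =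
      (![-(2 / 3 * (3 * α + 2 + β) * L.lam ^ 4 * x 1), 0, 0, 0] : Fin 4 → ℝ) j := by
  obtain ⟨h4, h5, h6, h7, h8, h9⟩ := hE
  obtain ⟨h16, h18, h19, h20, h21, h22⟩ := hF
  fin_cases j <;>
  simp [defectOne, alphaOne_eq h ⟨h4, h5, h6, h7, h8, h9⟩, L.flux_q_y h, equil, hQ.2.1, h4, h5,
    h6, h7, h8, h16, h18, h19, h20, h21, Fin.sum_univ_four]
  ring

theorem defectOne_q_z (h : L.lam ≠ 0) (hE : L.FirstOrderEquilibrium α)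
    (hQ : L.HeatFluxEquilibrium (-2)) (hF : L.FourthDegreeEquilibrium β) (x : Fin 3 → ℝ)
    (j : Fin 4) : L.defectOne x j 12 =
      (![-(2 / 3 * (3 * α + 2 + β) * L.lam ^ 4 * x 2), 0, 0, 0] : Fin 4 → ℝ) j := by
  obtain ⟨h4, h5, h6, h7, h8, h9⟩ := hE
  obtain ⟨h16, h18, h19, h20, h21, h22⟩ := hF
  fin_cases j <;>
  simp [defectOne, alphaOne_eq h ⟨h4, h5, h6, h7, h8, h9⟩, L.flux_q_z h, equil, hQ.2.2, h4, h5,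
    h6, h8, h9, h16, h18, h19, h21, h22, Fin.sum_univ_four]
  ring

/-- The fluxes of these moments involve only XX, WW, XY, YZ, ZX and their fourth degree
counterparts, all null at equilibrium. -/
theorem defectOne_third_order (h : L.lam ≠ 0) (hE : L.FirstOrderEquilibrium α)
    (hN : L.NullThirdOrderEquilibrium) (hF : L.FourthDegreeEquilibrium β) (x : Fin 3 → ℝ)
    (j : Fin 4) : L.defectOne x j 23 = 0 ∧ L.defectOne x j 24 = 0 ∧ L.defectOne x j 25 = 0 ∧
      L.defectOne x j 26 = 0 := by
  obtain ⟨h4, h5, h6, h7, h8, h9⟩ := hE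
  obtain ⟨h16, h18, h19, h20, h21, h22⟩ := hF
  obtain ⟨h23, h24, h25, h26⟩ := hN
  simp [defectOne, L.flux_antisymm_x h, L.flux_antisymm_y h, L.flux_antisymm_z h, L.flux_XYZ h,
    equil, h5, h6, h7, h8, h9, h18, h19, h20, h21, h22, h23, h24, h25, h26]

/-- The parameter δ, the common value of (3α + 2 + β)σ_k for k = 10, 11, 12, treats both families at
once: δ = 0 for the first one, δ = (3α + 2 + β)/(12σ₅) for the second. -/
theorem alphaThree_eq (h : L.lam ≠ 0) (hE : L.FirstOrderEquilibrium α)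
    (hQ : L.HeatFluxEquilibrium (-2)) (hN : L.NullThirdOrderEquilibrium)
    (hF : L.FourthDegreeEquilibrium β)
    (hσ : L.SecondOrderRelaxation) (h57 : L.sigma 5 = L.sigma 7)
    (h10 : (3 * α + 2 + β) * L.sigma 10 = δ) (h11 : (3 * α + 2 + β) * L.sigma 11 = δ)
    (h12 : (3 * α + 2 + β) * L.sigma 12 = δ) (hδ : 3 * α + 2 + β = 12 * L.sigma 5 * δ)
    (x : Fin 3 → ℝ) :
    L.alphaThree x = -acousticSymbol 0 0 0 ((α - 1) / 36 * L.lam ^ 2)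
      (((α + 2) / 54 * (1 - α + 6 * α * L.sigma 4 ^ 2 + 2 * L.sigma 4 ^ 2 - 8 * L.sigma 5 ^ 2)
        + 2 / 27 * δ * (L.sigma 4 - L.sigma 5)) * L.lam ^ 4) x
      + !![0, x 0, x 1, x 2; 0, 0, 0, 0; 0, 0, 0, 0; 0, 0, 0, 0] := by
  have h2 := alphaTwo_eq h hE hQ hN hσ (by rw [← h57]; ring) x
  obtain ⟨h6, h8, h9⟩ := hσ
  rw [eq_comm] at h6 h8 h9
  rw [h8] at h9
  rw [← h57] at h8 h9 h2
  have hc := fun j l => L.defectOne_conserved x j l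
  have d4 := defectOne_energy h hE hQ x
  have d5 := defectOne_XX h hE hQ hN x
  have d6 := defectOne_WW h hE hQ hN x
  have d7 := defectOne_XY h hE hQ hN x
  have d8 := defectOne_YZ h hE hQ hN x
  have d9 := defectOne_ZX h hE hQ hN x
  have d10 := defectOne_q_x h hE hQ hF x
  have d11 := defectOne_q_y h hE hQ hF x
  have d12 := defectOne_q_z h hE hQ hF x
  have d23 := fun j => (defectOne_third_order h hE hN hF x j).1
  have d24 := fun j => (defectOne_third_order h hE hN hF x j).2.1
  have d25 := fun j => (defectOne_third_order h hE hN hF x j).2.2.1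
  have d26 := fun j => (defectOne_third_order h hE hN hF x j).2.2.2
  have e10 : L.sigma 10 * (2 / 3 * (3 * α + 2 + β) * L.lam ^ 4 * x 0) =
      2 / 3 * δ * L.lam ^ 4 * x 0 := by rw [← h10]; ring
  have e11 : L.sigma 11 * (2 / 3 * (3 * α + 2 + β) * L.lam ^ 4 * x 1) =
      2 / 3 * δ * L.lam ^ 4 * x 1 := by rw [← h11]; ring
  have e12 : L.sigma 12 * (2 / 3 * (3 * α + 2 + β) * L.lam ^ 4 * x 2) =
      2 / 3 * δ * L.lam ^ 4 * x 2 := by rw [← h12]; ring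
  have h1 := alphaOne_eq h hE x
  obtain ⟨E4, E5, E6, E7, E8, E9⟩ := hE
  ext i j
  fin_cases i <;> fin_cases j <;>
  simp [alphaThree, defectTwo, castAdd_zero, castAdd_one, castAdd_two, castAdd_three,
    L.flux_density h,
    L.flux_momentum_x h, L.flux_momentum_y h, L.flux_momentum_z h,
    L.flux_energy h, L.flux_XX h, L.flux_WW h, L.flux_XY h, L.flux_YZ h, L.flux_ZX h,
    hc, d4, d5, d6, d7, d8, d9, d10, d11, d12, d23, d24, d25, d26, e10, e11, e12,
    E4, E5, E6, E7, E8, E9, h1, h2, Fin.sum_univ_four,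
    acousticSymbol, h6, h8, h9, h57.symm]
  · ring
  · ring
  · ring
  -- The defect of q enters through XX, WW, XY, YZ, ZX with the anisotropic weight σ₅δ - (3α + 2 +
  -- β)/12, which `hδ` makes zero. The energy channel leaves the isotropic term in δ(σ₄ - σ₅).
  · rw [hδ]; ring
  · rw [hδ]; ring
  · rw [hδ]; ring

theorem equivOp_three_eq (h : L.lam ≠ 0) (hs : ∀ k : Fin 27, 4 ≤ k → 0 < L.s k)
    (hE : L.FirstOrderEquilibrium α)
    (hQ : L.HeatFluxEquilibrium (-2)) (hN : L.NullThirdOrderEquilibrium)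
    (hF : L.FourthDegreeEquilibrium β)
    (hσ : L.SecondOrderRelaxation) (h57 : L.sigma 5 = L.sigma 7)
    (h10 : (3 * α + 2 + β) * L.sigma 10 = δ) (h11 : (3 * α + 2 + β) * L.sigma 11 = δ)
    (h12 : (3 * α + 2 + β) * L.sigma 12 = δ) (hδ : 3 * α + 2 + β = 12 * L.sigma 5 * δ) :
    L.equivOp 3 = acousticOp ((α + 2) / 3 * L.lam ^ 2)
      (1 / 3 * L.sigma 5 * L.lam * L.dx)
      (1 / 9 * (L.sigma 5 - L.sigma 4 * (1 + 3 * α)) * L.lam * L.dx)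
      (1 / 36 * (α - 1) * L.dx ^ 2)
      (((α + 2) / 54 * (1 - α + 6 * α * L.sigma 4 ^ 2 + 2 * L.sigma 4 ^ 2 - 8 * L.sigma 5 ^ 2)
        + 2 / 27 * δ * (L.sigma 4 - L.sigma 5)) * L.lam ^ 2 * L.dx ^ 2) := by
  ext1 i j
  refine MvPolynomial.funext fun x => ?_
  rw [eval_acousticOp, L.eval_equivOp_three h hs, alphaOne_eq h hE,
    alphaTwo_eq h hE hQ hN hσ (by rw [← h57]; ring),
    alphaThree_eq h hE hQ hN hF hσ h57 h10 h11 h12 hδ, ← h57]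
  have hdx : L.dx = L.dt * L.lam := by rw [dt, div_mul_cancel₀ _ h]
  rw [hdx]
  fin_cases i <;> fin_cases j <;> simp [acousticSymbol] <;> ring

end Isotropic
end D3Q27

/-- The symbol of a rotation invariant system. -/
theorem IsRotationInvariant.eval {G : Matrix (Fin 4) (Fin 4) Op} (h : IsRotationInvariant G) :
    ∃ d m e f : ℝ → ℝ, ∀ (x : Fin 3 → ℝ) (i j : Fin 3),
      MvPolynomial.eval x (G i.succ 0) = d (x 0 ^ 2 + x 1 ^ 2 + x 2 ^ 2) * x i ∧
      MvPolynomial.eval x (G i.succ j.succ) = (if i = j then m (x 0 ^ 2 + x 1 ^ 2 + x 2 ^ 2) else 0)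
        + e (x 0 ^ 2 + x 1 ^ 2 + x 2 ^ 2) * (x i * x j)
        + f (x 0 ^ 2 + x 1 ^ 2 + x 2 ^ 2) * MvPolynomial.eval x (curl i j) := by
  obtain ⟨n, a, b, d, m, e, f, rfl⟩ := h
  have hlap (x : Fin 3 → ℝ) : MvPolynomial.eval x lap = x 0 ^ 2 + x 1 ^ 2 + x 2 ^ 2 := by
    simp [lap, pd, Fin.sum_univ_three]
  refine ⟨fun t => ∑ k ∈ Finset.range n, d k * t ^ k, fun t => ∑ k ∈ Finset.range n, m k * t ^ k,
    fun t => ∑ k ∈ Finset.range n, e k * t ^ k, fun t => ∑ k ∈ Finset.range n, f k * t ^ k,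
    fun x i j => ⟨?_, ?_⟩⟩
  · simp only [Matrix.sum_apply, blockOp_succ_zero, map_sum, MvPolynomial.smul_eval, map_mul,
      map_pow, hlap, Finset.sum_mul]
    refine Finset.sum_congr rfl fun k _ => ?_
    simp [pd]
    ring
  · simp only [Matrix.sum_apply, blockOp_succ_succ, map_sum, Finset.sum_mul]
    have hite : (if i = j then ∑ k ∈ Finset.range n, m k * (x 0 ^ 2 + x 1 ^ 2 + x 2 ^ 2) ^ k else 0)
        = ∑ k ∈ Finset.range n,
          if i = j then m k * (x 0 ^ 2 + x 1 ^ 2 + x 2 ^ 2) ^ k else 0 := by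
      split_ifs <;> simp
    rw [hite, ← Finset.sum_add_distrib, ← Finset.sum_add_distrib]
    refine Finset.sum_congr rfl fun k _ => ?_
    simp only [Matrix.of_apply, map_add, MvPolynomial.smul_eval, map_mul, map_pow, hlap, pd,
      MvPolynomial.eval_X]
    split_ifs
    · simp [MvPolynomial.smul_eval, hlap]
      ring
    · simp
      ring

/-! ### Necessity of the second order conditions -/

namespace D3Q27

theorem alphaTwo_momentum_x (L : D3Q27) (h : L.lam ≠ 0) (x : Fin 3 → ℝ) (j : Fin 4) :
    L.alphaTwo x 1 j = -(x 0 * (1 / 3 * (L.sigma 4 * L.defectOne x j 4)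
        + 1 / 3 * (L.sigma 5 * L.defectOne x j 5))
      + x 1 * (L.sigma 7 * L.defectOne x j 7) + x 2 * (L.sigma 9 * L.defectOne x j 9)) := by
  rw [alphaTwo, castAdd_one, L.flux_momentum_x h, L.defectOne_conserved x j 0 (by simp)]
  ring

theorem alphaTwo_momentum_y (L : D3Q27) (h : L.lam ≠ 0) (x : Fin 3 → ℝ) (j : Fin 4) :
    L.alphaTwo x 2 j = -(x 0 * (L.sigma 7 * L.defectOne x j 7)
      + x 1 * (1 / 3 * (L.sigma 4 * L.defectOne x j 4) - 1 / 6 * (L.sigma 5 * L.defectOne x j 5)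
        + 1 / 2 * (L.sigma 6 * L.defectOne x j 6)) + x 2 * (L.sigma 8 * L.defectOne x j 8)) := by
  rw [alphaTwo, castAdd_two, L.flux_momentum_y h, L.defectOne_conserved x j 0 (by simp)]
  ring

theorem alphaTwo_momentum_z (L : D3Q27) (h : L.lam ≠ 0) (x : Fin 3 → ℝ) (j : Fin 4) :
    L.alphaTwo x 3 j = -(x 0 * (L.sigma 9 * L.defectOne x j 9)
      + x 1 * (L.sigma 8 * L.defectOne x j 8)
      + x 2 * (1 / 3 * (L.sigma 4 * L.defectOne x j 4) - 1 / 6 * (L.sigma 5 * L.defectOne x j 5)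
        - 1 / 2 * (L.sigma 6 * L.defectOne x j 6))) := by
  rw [alphaTwo, castAdd_three, L.flux_momentum_z h, L.defectOne_conserved x j 0 (by simp)]
  ring

section FirstOrder

variable {L : D3Q27} {α : ℝ}

/-- Among these moments only ε has a nonzero equilibrium, so the correction Eα₁ survives in row 4
alone. -/
theorem defectOne_second_degree (hE : L.FirstOrderEquilibrium α) (x : Fin 3 → ℝ)
    (j : Fin 4) :
    L.defectOne x j 4 = L.flux x (L.equil j) 4 - α * L.lam ^ 2 * L.alphaOne x 0 j ∧
    L.defectOne x j 5 = L.flux x (L.equil j) 5 ∧ L.defectOne x j 6 = L.flux x (L.equil j) 6 ∧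
    L.defectOne x j 7 = L.flux x (L.equil j) 7 ∧ L.defectOne x j 8 = L.flux x (L.equil j) 8 ∧
    L.defectOne x j 9 = L.flux x (L.equil j) 9 := by
  obtain ⟨h4, h5, h6, h7, h8, h9⟩ := hE
  simp [defectOne, h4, h5, h6, h7, h8, h9, Fin.sum_univ_four]

/-- Defects and fluxes are each linear in x, so α₂ is quadratic. -/
theorem alphaTwo_neg (h : L.lam ≠ 0) (hE : L.FirstOrderEquilibrium α) (x : Fin 3 → ℝ)
    (i : Fin 3) (j : Fin 4) : L.alphaTwo (-x) i.succ j = L.alphaTwo x i.succ j := by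
  obtain ⟨p4, p5, p6, p7, p8, p9⟩ := defectOne_second_degree hE x j
  obtain ⟨n4, n5, n6, n7, n8, n9⟩ := defectOne_second_degree hE (-x) j
  fin_cases i
  · change L.alphaTwo (-x) 1 j = L.alphaTwo x 1 j
    simp only [L.alphaTwo_momentum_x h, p4, p5, p7, p9, n4, n5, n7, n9, L.flux_energy h,
      L.flux_XX h, L.flux_XY h, L.flux_ZX h, alphaOne, castAdd_zero, L.flux_density h,
      Pi.neg_apply]
    ring
  · change L.alphaTwo (-x) 2 j = L.alphaTwo x 2 j
    simp only [L.alphaTwo_momentum_y h, p4, p5, p6, p7, p8, n4, n5, n6, n7, n8, L.flux_energy h,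
      L.flux_XX h, L.flux_WW h, L.flux_XY h, L.flux_YZ h, alphaOne, castAdd_zero,
      L.flux_density h, Pi.neg_apply]
    ring
  · change L.alphaTwo (-x) 3 j = L.alphaTwo x 3 j
    simp only [L.alphaTwo_momentum_z h, p4, p5, p6, p8, p9, n4, n5, n6, n8, n9, L.flux_energy h,
      L.flux_XX h, L.flux_WW h, L.flux_YZ h, L.flux_ZX h, alphaOne, castAdd_zero,
      L.flux_density h, Pi.neg_apply]
    ring

/-- At second order, a rotation invariant scheme has a quadratic rotation invariant symbol. -/
theorem alphaTwo_of_isotropic (h : L.lam ≠ 0) (hdx : L.dx ≠ 0)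
    (hs : ∀ k : Fin 27, 4 ≤ k → 0 < L.s k) (hE : L.FirstOrderEquilibrium α)
    (hI : L.IsotropicAtOrder 2) :
    (∀ (x : Fin 3 → ℝ) (i : Fin 3), L.alphaTwo x i.succ 0 = 0) ∧
    ∃ m e : ℝ → ℝ, ∀ (x : Fin 3 → ℝ) (i j : Fin 3), L.alphaTwo x i.succ j.succ =
      (if i = j then m (x 0 ^ 2 + x 1 ^ 2 + x 2 ^ 2) else 0)
        + e (x 0 ^ 2 + x 1 ^ 2 + x 2 ^ 2) * (x i * x j) := by
  obtain ⟨d, m, e, f, H⟩ := hI.eval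
  have hdt : L.dt ≠ 0 := div_ne_zero hdx h
  have hodd (x : Fin 3 → ℝ) (i : Fin 3) (j : Fin 4) :
      L.alphaOne (-x) i.succ j = -L.alphaOne x i.succ j := by
    rw [alphaOne_eq h hE, alphaOne_eq h hE]
    fin_cases i <;> fin_cases j <;> simp
  simp only [L.eval_equivOp_two h hs] at H
  -- The even part of the symbol of `equivOp 2` is -Δt α₂, whence the sign and the division by Δt.
  -- The gradient and curl terms are odd and drop out.
  refine ⟨fun x i => ?_, fun t => -(m t / L.dt), fun t => -(e t / L.dt), fun x i j => ?_⟩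
  · have h1 := (H x i i).1
    have h2 := (H (-x) i i).1
    simp only [hodd, alphaTwo_neg h hE, Pi.neg_apply, neg_sq] at h2
    have : L.dt * L.alphaTwo x i.succ 0 = 0 := by linarith
    exact (mul_eq_zero.1 this).resolve_left hdt
  · have h1 := (H x i j).2
    have h2 := (H (-x) i j).2
    have hcurl : MvPolynomial.eval (-x) (curl i j) = -MvPolynomial.eval x (curl i j) := by
      fin_cases i <;> fin_cases j <;> simp [curl, pd]
    simp only [hodd, alphaTwo_neg h hE, Pi.neg_apply, neg_sq, hcurl] at h2
    rw [eq_comm]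
    refine mul_left_cancel₀ hdt ?_
    split_ifs at h1 h2 ⊢
    · field_simp
      linarith
    · field_simp
      linarith

end FirstOrder

/-- The algebraic system for the relaxation parameters and the moments of degree three that
expresses the isotropy at second order. -/
theorem isotropic_parameters {s₄ s₅ s₆ s₇ s₈ s₉ l c u v w m e : ℝ} (h₅ : 0 < s₅) (h₆ : 0 < s₆)
    (h₇ : 0 < s₇) (hl : 0 < l) (h7 : s₇ * u = m) (h8 : s₈ * v = m) (h9 : s₉ * w = m)
    (hyx : e = s₄ * (u + w - c) / 3 - s₅ * (2 * l - u - w) / 6 + s₆ * (u - w) / 2 + m)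
    (hzx : e = s₄ * (u + w - c) / 3 - s₅ * (2 * l - u - w) / 6 - s₆ * (u - w) / 2 + m)
    (hxx : m + e = s₄ * (u + w - c) / 3 + s₅ * (2 * l - u - w) / 3)
    (hxy : e = s₄ * (u + v - c) / 3 + s₅ * (2 * u - l - v) / 3 + m)
    (hzy : e = s₄ * (u + v - c) / 3 - s₅ * (2 * u - l - v) / 6 - s₆ * (l - v) / 2 + m)
    (hyy : m + e = s₄ * (u + v - c) / 3 - s₅ * (2 * u - l - v) / 6 + s₆ * (l - v) / 2) :
    s₅ = s₆ ∧ s₇ = s₈ ∧ s₈ = s₉ ∧ v = u ∧ w = u ∧ u * (s₅ + 2 * s₇) = s₅ * l := by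
  -- Difference of `hyx` and `hzx`.
  have hw : w = u := by
    have : s₆ * (u - w) = 0 := by linarith
    linarith [(mul_eq_zero.1 this).resolve_left h₆.ne']
  subst hw
  -- Difference of `hxx` and `hyx`, with w = u.
  have hm : 2 * m = s₅ * (l - w) := by linarith
  -- The equations `hxy`, `hzy`, `hyy` give 2m = s₆(l - v) = s₅(l + v - 2w), to be compared with 2m
  -- = s₅(l - w).
  have hv : v = w := by
    have : s₅ * (v - w) = 0 := by linarith
    linarith [(mul_eq_zero.1 this).resolve_left h₅.ne']
  subst hv
  have hm' : 2 * m = s₆ * (l - v) := by linarith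
  -- Either degeneracy, v = 0 or v = l, would force m = 0 and contradict positivity; the s_k can
  -- then be identified by cancelling v and l - v.
  have hv0 : v ≠ 0 := by
    rintro rfl
    have : s₅ * l = 0 := by linarith
    exact (mul_pos h₅ hl).ne' this
  have hm0 : l - v ≠ 0 := by
    intro h0
    rw [h0] at hm
    have : s₇ * v = 0 := by linarith
    exact hv0 ((mul_eq_zero.1 this).resolve_left h₇.ne')
  exact ⟨mul_right_cancel₀ hm0 (by linarith), mul_right_cancel₀ hv0 (by linarith),
    mul_right_cancel₀ hv0 (by linarith), rfl, rfl, by linarith⟩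

section Converse

variable {L : D3Q27} {α : ℝ}

/-- Axis wave vectors isolate each transverse coefficient of XY, YZ, ZX, up to a positive σ. The
moment XYZ appears only for a mixed direction, with the factor σ₇ + σ₉. -/
theorem null_density_column (h : L.lam ≠ 0) (hE : L.FirstOrderEquilibrium α)
    (h7 : 0 < L.sigma 7) (h8 : 0 < L.sigma 8) (h9 : 0 < L.sigma 9)
    (H : ∀ (x : Fin 3 → ℝ) (i : Fin 3), L.alphaTwo x i.succ 0 = 0) :
    L.E 10 0 = 0 ∧ L.E 11 0 = 0 ∧ L.E 12 0 = 0 ∧ L.E 23 0 = 0 ∧ L.E 24 0 = 0 ∧ L.E 25 0 = 0 ∧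
      L.E 26 0 = 0 := by
  have key (x : Fin 3 → ℝ) := defectOne_second_degree hE x 0
  have hx (x : Fin 3 → ℝ) := H x 0
  have hy (x : Fin 3 → ℝ) := H x 1
  have hz (x : Fin 3 → ℝ) := H x 2
  simp only [Fin.succ_zero_eq_one, Fin.succ_one_eq_two, show (2 : Fin 3).succ = 3 from rfl,
    L.alphaTwo_momentum_x h, L.alphaTwo_momentum_y h, L.alphaTwo_momentum_z h, key,
    L.flux_energy h, L.flux_XX h, L.flux_WW h, L.flux_XY h, L.flux_YZ h, L.flux_ZX h,
    alphaOne_eq h hE] at hx hy hz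
  simp [equil] at hx hy hz
  have hxy := hx ![0, 1, 0]
  have hxz := hx ![0, 0, 1]
  have hyx := hy ![1, 0, 0]
  have hyz := hy ![0, 0, 1]
  have hzx := hz ![1, 0, 0]
  have hzy := hz ![0, 1, 0]
  have hd := hx ![0, 1, 1]
  simp [h7.ne', h8.ne', h9.ne'] at hxy hxz hyx hyz hzx hzy hd
  have e10 : L.E 10 0 = 0 := by linarith
  have e23 : L.E 23 0 = 0 := by linarith
  refine ⟨e10, by linarith, by linarith, e23, by linarith, by linarith, ?_⟩
  have : (L.sigma 9 + L.sigma 7) * L.E 26 0 = 0 := by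
    rw [e10, e23] at hd
    linarith
  exact (mul_eq_zero.1 this).resolve_left (by positivity)

theorem add_sub_eq_zero {s s' q t : ℝ} (hs : 0 < s) (hs' : 0 < s') (h : s * (q / 6 + t / 2) = 0)
    (h' : s' * (q / 6 - t / 2) = 0) : q = 0 ∧ t = 0 := by
  have h1 := (mul_eq_zero.1 h).resolve_left hs.ne'
  have h2 := (mul_eq_zero.1 h').resolve_left hs'.ne'
  constructor <;> linarith

/-- The numbers u and w are the opposites of the coefficients of ∂_y in the XY defect and of ∂_z in
the ZX defect, for the column J_x. Axis points of the sphere give the vanishing entries and the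
shear relations; points of type (3,4,0) give the cross terms. The normalization 25m absorbs |x|² =
25. -/
theorem momentum_x_column (h : L.lam ≠ 0) (hE : L.FirstOrderEquilibrium α)
    (h7 : 0 < L.sigma 7) (h8 : 0 < L.sigma 8) (h9 : 0 < L.sigma 9) {m e : ℝ}
    (H : ∀ (x : Fin 3 → ℝ) (i : Fin 3), x 0 ^ 2 + x 1 ^ 2 + x 2 ^ 2 = 25 →
      L.alphaTwo x i.succ 1 = (if i = 0 then 25 * m else 0) + e * (x i * x 0)) :
    L.E 11 1 = 0 ∧ L.E 12 1 = 0 ∧ L.E 24 1 = 0 ∧ L.E 25 1 = 0 ∧ L.E 26 1 = 0 ∧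
    ∃ u w : ℝ, L.E 10 1 = 3 * (u + w) - 4 * L.lam ^ 2 ∧ L.E 23 1 = u - w ∧
      L.sigma 7 * u = m ∧ L.sigma 9 * w = m ∧
      e = L.sigma 4 * (u + w - (1 + α) * L.lam ^ 2) / 3 - L.sigma 5 * (2 * L.lam ^ 2 - u - w) / 6
        + L.sigma 6 * (u - w) / 2 + m ∧
      e = L.sigma 4 * (u + w - (1 + α) * L.lam ^ 2) / 3 - L.sigma 5 * (2 * L.lam ^ 2 - u - w) / 6
        - L.sigma 6 * (u - w) / 2 + m ∧
      m + e = L.sigma 4 * (u + w - (1 + α) * L.lam ^ 2) / 3 + L.sigma 5 * (2 * L.lam ^ 2 - u - w) / 3 := by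
  have key (x : Fin 3 → ℝ) := defectOne_second_degree hE x 1
  have hx (a b c : ℝ) := H ![a, b, c] 0
  have hy (a b c : ℝ) := H ![a, b, c] 1
  have hz (a b c : ℝ) := H ![a, b, c] 2
  simp only [Fin.succ_zero_eq_one, Fin.succ_one_eq_two, show (2 : Fin 3).succ = 3 from rfl,
    L.alphaTwo_momentum_x h, L.alphaTwo_momentum_y h, L.alphaTwo_momentum_z h, key,
    L.flux_energy h, L.flux_XX h, L.flux_WW h, L.flux_XY h, L.flux_YZ h, L.flux_ZX h,
    alphaOne_eq h hE] at hx hy hz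
  simp [equil] at hx hy hz
  obtain ⟨e11, e24⟩ : L.E 11 1 = 0 ∧ L.E 24 1 = 0 :=
    add_sub_eq_zero h8 h7 (by linarith only [hy 0 0 5 (by norm_num)])
      (by linarith only [hy 5 0 0 (by norm_num)])
  obtain ⟨e12, e25⟩ : L.E 12 1 = 0 ∧ L.E 25 1 = 0 :=
    add_sub_eq_zero h9 h8 (by linarith only [hz 5 0 0 (by norm_num)])
      (by linarith only [hz 0 5 0 (by norm_num)])
  simp only [e11, e12, e24, e25, mul_zero, add_zero, zero_add, sub_zero, neg_zero] at hx hy hz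
  have h₁ : L.sigma 7 * (2 / 3 * L.lam ^ 2 + L.E 10 1 / 6 + L.E 23 1 / 2) = m := by
    linarith only [hx 0 5 0 (by norm_num)]
  have h₂ : L.sigma 9 * (2 / 3 * L.lam ^ 2 + L.E 10 1 / 6 - L.E 23 1 / 2) = m := by
    linarith only [hx 0 0 5 (by norm_num)]
  have e26 : L.E 26 1 = 0 := by
    have : (L.sigma 7 + L.sigma 9) * L.E 26 1 = 0 := by
      linarith only [h₁, h₂, hx 0 3 4 (by norm_num)]
    exact (mul_eq_zero.1 this).resolve_left (by positivity)
  simp only [e26, mul_zero, add_zero, zero_add, neg_zero] at hx hy hz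
  refine ⟨e11, e12, e24, e25, e26, _, _, by ring, by ring, h₁, h₂, ?_, ?_, ?_⟩
  · linarith only [h₁, h₂, hy 3 4 0 (by norm_num)]
  · linarith only [h₁, h₂, hz 3 0 4 (by norm_num)]
  · linarith only [h₁, h₂, hx 5 0 0 (by norm_num)]

/-- The same method for J_y; here u and v come from ∂_x in XY and ∂_z in YZ. -/
theorem momentum_y_column (h : L.lam ≠ 0) (hE : L.FirstOrderEquilibrium α)
    (h7 : 0 < L.sigma 7) (h8 : 0 < L.sigma 8) (h9 : 0 < L.sigma 9) {m e : ℝ}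
    (H : ∀ (x : Fin 3 → ℝ) (i : Fin 3), x 0 ^ 2 + x 1 ^ 2 + x 2 ^ 2 = 25 →
      L.alphaTwo x i.succ 2 = (if i = 1 then 25 * m else 0) + e * (x i * x 1)) :
    L.E 10 2 = 0 ∧ L.E 12 2 = 0 ∧ L.E 23 2 = 0 ∧ L.E 25 2 = 0 ∧ L.E 26 2 = 0 ∧
    ∃ u v : ℝ, L.E 11 2 = 3 * (u + v) - 4 * L.lam ^ 2 ∧ L.E 24 2 = v - u ∧
      L.sigma 7 * u = m ∧ L.sigma 8 * v = m ∧
      e = L.sigma 4 * (u + v - (1 + α) * L.lam ^ 2) / 3 + L.sigma 5 * (2 * u - L.lam ^ 2 - v) / 3 + m ∧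
      e = L.sigma 4 * (u + v - (1 + α) * L.lam ^ 2) / 3 - L.sigma 5 * (2 * u - L.lam ^ 2 - v) / 6
        - L.sigma 6 * (L.lam ^ 2 - v) / 2 + m ∧
      m + e = L.sigma 4 * (u + v - (1 + α) * L.lam ^ 2) / 3 - L.sigma 5 * (2 * u - L.lam ^ 2 - v) / 6
        + L.sigma 6 * (L.lam ^ 2 - v) / 2 := by
  have key (x : Fin 3 → ℝ) := defectOne_second_degree hE x 2
  have hx (a b c : ℝ) := H ![a, b, c] 0
  have hy (a b c : ℝ) := H ![a, b, c] 1
  have hz (a b c : ℝ) := H ![a, b, c] 2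
  simp only [Fin.succ_zero_eq_one, Fin.succ_one_eq_two, show (2 : Fin 3).succ = 3 from rfl,
    L.alphaTwo_momentum_x h, L.alphaTwo_momentum_y h, L.alphaTwo_momentum_z h, key,
    L.flux_energy h, L.flux_XX h, L.flux_WW h, L.flux_XY h, L.flux_YZ h, L.flux_ZX h,
    alphaOne_eq h hE] at hx hy hz
  simp [equil] at hx hy hz
  obtain ⟨e10, e23⟩ : L.E 10 2 = 0 ∧ L.E 23 2 = 0 :=
    add_sub_eq_zero h7 h9 (by linarith only [hx 0 5 0 (by norm_num)])
      (by linarith only [hx 0 0 5 (by norm_num)])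
  obtain ⟨e12, e25⟩ : L.E 12 2 = 0 ∧ L.E 25 2 = 0 :=
    add_sub_eq_zero h9 h8 (by linarith only [hz 5 0 0 (by norm_num)])
      (by linarith only [hz 0 5 0 (by norm_num)])
  simp only [e10, e12, e23, e25, mul_zero, add_zero, zero_add, sub_zero, neg_zero] at hx hy hz
  have h₁ : L.sigma 7 * (2 / 3 * L.lam ^ 2 + L.E 11 2 / 6 - L.E 24 2 / 2) = m := by
    linarith only [hy 5 0 0 (by norm_num)]
  have h₂ : L.sigma 8 * (2 / 3 * L.lam ^ 2 + L.E 11 2 / 6 + L.E 24 2 / 2) = m := by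
    linarith only [hy 0 0 5 (by norm_num)]
  have e26 : L.E 26 2 = 0 := by
    have : (L.sigma 7 + L.sigma 8) * L.E 26 2 = 0 := by
      linarith only [h₁, h₂, hy 3 0 4 (by norm_num)]
    exact (mul_eq_zero.1 this).resolve_left (by positivity)
  simp only [e26, mul_zero, add_zero, zero_add, neg_zero] at hx hy hz
  refine ⟨e10, e12, e23, e25, e26, _, _, by ring, by ring, h₁, h₂, ?_, ?_, ?_⟩
  · linarith only [h₁, h₂, hx 3 4 0 (by norm_num)]
  · linarith only [h₁, h₂, hz 0 3 4 (by norm_num)]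
  · linarith only [h₁, h₂, hy 0 5 0 (by norm_num)]

/-- For J_z the shear relations suffice, since the first two columns already provide enough
equations for `isotropic_parameters`. -/
theorem momentum_z_column (h : L.lam ≠ 0) (hE : L.FirstOrderEquilibrium α)
    (h7 : 0 < L.sigma 7) (h8 : 0 < L.sigma 8) (h9 : 0 < L.sigma 9) {m e : ℝ}
    (H : ∀ (x : Fin 3 → ℝ) (i : Fin 3), x 0 ^ 2 + x 1 ^ 2 + x 2 ^ 2 = 25 →
      L.alphaTwo x i.succ 3 = (if i = 2 then 25 * m else 0) + e * (x i * x 2)) :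
    L.E 10 3 = 0 ∧ L.E 11 3 = 0 ∧ L.E 23 3 = 0 ∧ L.E 24 3 = 0 ∧ L.E 26 3 = 0 ∧
    ∃ w v : ℝ, L.E 12 3 = 3 * (w + v) - 4 * L.lam ^ 2 ∧ L.E 25 3 = w - v ∧
      L.sigma 9 * w = m ∧ L.sigma 8 * v = m := by
  have key (x : Fin 3 → ℝ) := defectOne_second_degree hE x 3
  have hx (a b c : ℝ) := H ![a, b, c] 0
  have hy (a b c : ℝ) := H ![a, b, c] 1
  have hz (a b c : ℝ) := H ![a, b, c] 2
  simp only [Fin.succ_zero_eq_one, Fin.succ_one_eq_two, show (2 : Fin 3).succ = 3 from rfl,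
    L.alphaTwo_momentum_x h, L.alphaTwo_momentum_y h, L.alphaTwo_momentum_z h, key,
    L.flux_energy h, L.flux_XX h, L.flux_WW h, L.flux_XY h, L.flux_YZ h, L.flux_ZX h,
    alphaOne_eq h hE] at hx hy hz
  simp [equil] at hx hy hz
  obtain ⟨e10, e23⟩ : L.E 10 3 = 0 ∧ L.E 23 3 = 0 :=
    add_sub_eq_zero h7 h9 (by linarith only [hx 0 5 0 (by norm_num)])
      (by linarith only [hx 0 0 5 (by norm_num)])
  obtain ⟨e11, e24⟩ : L.E 11 3 = 0 ∧ L.E 24 3 = 0 :=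
    add_sub_eq_zero h8 h7 (by linarith only [hy 0 0 5 (by norm_num)])
      (by linarith only [hy 5 0 0 (by norm_num)])
  simp only [e10, e11, e23, e24, mul_zero, add_zero, zero_add, sub_zero, neg_zero] at hx hy hz
  have h₁ : L.sigma 9 * (2 / 3 * L.lam ^ 2 + L.E 12 3 / 6 + L.E 25 3 / 2) = m := by
    linarith only [hz 5 0 0 (by norm_num)]
  have h₂ : L.sigma 8 * (2 / 3 * L.lam ^ 2 + L.E 12 3 / 6 - L.E 25 3 / 2) = m := by
    linarith only [hz 0 5 0 (by norm_num)]
  have e26 : L.E 26 3 = 0 := by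
    have : (L.sigma 9 + L.sigma 8) * L.E 26 3 = 0 := by
      linarith only [h₁, h₂, hz 3 4 0 (by norm_num)]
    exact (mul_eq_zero.1 this).resolve_left (by positivity)
  refine ⟨e10, e11, e23, e24, e26, _, _, by ring, by ring, h₁, h₂⟩

end Converse
theorem sigma_pos (L : D3Q27) {k : Fin 27} (h0 : 0 < L.s k) (h2 : L.s k < 2) : 0 < L.sigma k := by
  rw [sigma, sub_pos]
  exact one_div_lt_one_div_of_lt h0 h2

theorem second_order_conditions_of_isotropic {L : D3Q27} {α : ℝ} (hlam : 0 < L.lam)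
    (hdx : 0 < L.dx) (hs : ∀ k : Fin 27, 4 ≤ k → 0 < L.s k) (hE : L.FirstOrderEquilibrium α)
    (hs2 : ∀ k : Fin 27, 4 ≤ k → L.s k < 2) (hI : L.IsotropicAtOrder 2) :
    L.SecondOrderRelaxation ∧
      L.HeatFluxEquilibrium (2 * ((L.sigma 5 - 4 * L.sigma 7) / (L.sigma 5 + 2 * L.sigma 7))) ∧
      L.NullThirdOrderEquilibrium := by
  have h := hlam.ne'
  have hσ (k : Fin 27) (hk : 4 ≤ k) : 0 < L.sigma k := L.sigma_pos (hs k hk) (hs2 k hk)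
  have h5 := hσ 5 (by decide)
  have h6 := hσ 6 (by decide)
  have h7 := hσ 7 (by decide)
  have h8 := hσ 8 (by decide)
  have h9 := hσ 9 (by decide)
  obtain ⟨H0, m, e, H⟩ := alphaTwo_of_isotropic h hdx.ne' hs hE hI
  have H' (j : Fin 3) (x : Fin 3 → ℝ) (i : Fin 3) (hx : x 0 ^ 2 + x 1 ^ 2 + x 2 ^ 2 = 25) :
      L.alphaTwo x i.succ j.succ = (if i = j then 25 * (m 25 / 25) else 0) + e 25 * (x i * x j) := by
    rw [H x i j, hx, mul_div_cancel₀ _ (by norm_num)]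
  obtain ⟨a10, a11, a12, a23, a24, a25, a26⟩ := null_density_column h hE h7 h8 h9 H0
  obtain ⟨b11, b12, b24, b25, b26, u, w, b10, b23, hu, hw, hyx, hzx, hxx⟩ :=
    momentum_x_column h hE h7 h8 h9 (H' 0)
  obtain ⟨c10, c12, c23, c25, c26, u', v, c11, c24, hu', hv, hxy, hzy, hyy⟩ :=
    momentum_y_column h hE h7 h8 h9 (H' 1)
  obtain ⟨d10, d11, d23, d24, d26, w', v', d12, d25, hw', hv'⟩ :=
    momentum_z_column h hE h7 h8 h9 (H' 2)
  -- Shear coefficients read in different columns agree because σ_k times each of them is the same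
  -- m.
  obtain rfl : u' = u := mul_left_cancel₀ h7.ne' (by rw [hu, hu'])
  obtain rfl : v' = v := mul_left_cancel₀ h8.ne' (by rw [hv, hv'])
  obtain rfl : w' = w := mul_left_cancel₀ h9.ne' (by rw [hw, hw'])
  obtain ⟨s56, s78, s89, rfl, rfl, key⟩ := isotropic_parameters h5 h6 h7 (pow_pos hlam 2) hu hv hw
    hyx hzx hxx hxy hzy hyy
  have hpos : L.sigma 5 + 2 * L.sigma 7 ≠ 0 := by positivity
  -- By `key`, u = σ₅λ²/(σ₅ + 2σ₇), and κλ² = 6u - 4λ².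
  have hκ : 3 * (w' + w') - 4 * L.lam ^ 2 =
      2 * ((L.sigma 5 - 4 * L.sigma 7) / (L.sigma 5 + 2 * L.sigma 7)) * L.lam ^ 2 := by
    field_simp
    linear_combination 6 * key
  rw [hκ] at b10 c11 d12
  rw [sub_self] at b23 c24 d25
  refine ⟨⟨s56, s78, s89⟩, ⟨?_, ?_, ?_⟩, ?_, ?_, ?_, ?_⟩ <;> ext j <;> fin_cases j <;>
    simp [*]

end D3Q27
end LBM

theorem mainTheorem5 (L : LBM.D3Q27) (hlam : 0 < L.lam) (hdx : 0 < L.dx)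
    (hs : ∀ k : Fin 27, 4 ≤ k → 0 < L.s k)
    (α : ℝ) (hE : L.FirstOrderEquilibrium α) :
    -- first order
    (L.IsotropicAtOrder 1 ∧
      L.equivOp 1 = LBM.acousticOp ((α + 2) / 3 * L.lam ^ 2) 0 0 0 0) ∧
    -- second order
    (L.SecondOrderRelaxation →
      L.sigma 5 + 2 * L.sigma 7 ≠ 0 →
      L.HeatFluxEquilibrium
        (2 * ((L.sigma 5 - 4 * L.sigma 7) / (L.sigma 5 + 2 * L.sigma 7))) →
      L.NullThirdOrderEquilibrium →
      L.IsotropicAtOrder 2 ∧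
      ∃ μ ζ : ℝ,
        L.equivOp 2 = LBM.acousticOp ((α + 2) / 3 * L.lam ^ 2) μ ζ 0 0 ∧
        μ = L.sigma 5 * L.sigma 7 / (L.sigma 5 + 2 * L.sigma 7) * L.lam * L.dx ∧
        3 * ζ - μ = L.lam * L.sigma 4 * L.dx / (L.sigma 5 + 2 * L.sigma 7) *
          (L.sigma 5 - 2 * L.sigma 7 - α * L.sigma 5 - 2 * α * L.sigma 7)) ∧
    -- these conditions have to be imposed when the stability condition holds
    ((∀ k : Fin 27, 4 ≤ k → L.s k < 2) →
      L.IsotropicAtOrder 2 →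
      L.SecondOrderRelaxation ∧
      L.HeatFluxEquilibrium
        (2 * ((L.sigma 5 - 4 * L.sigma 7) / (L.sigma 5 + 2 * L.sigma 7))) ∧
      L.NullThirdOrderEquilibrium) ∧
    -- third order, first family
    (L.SecondOrderRelaxation →
      L.sigma 5 = L.sigma 7 →
      L.HeatFluxEquilibrium (-2) →
      L.NullThirdOrderEquilibrium →
      L.FourthDegreeEquilibrium (-(2 + 3 * α)) →
      L.IsotropicAtOrder 3 ∧
      ∃ μ ζ ξ χ : ℝ,
        L.equivOp 3 = LBM.acousticOp ((α + 2) / 3 * L.lam ^ 2) μ ζ ξ χ ∧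
        μ = 1 / 3 * L.sigma 5 * L.lam * L.dx ∧
        3 * ζ - μ = -(1 / 3) * L.sigma 4 * (1 + 3 * α) * L.lam * L.dx ∧
        ξ = 1 / 36 * (α - 1) * L.dx ^ 2 ∧
        χ = 1 / 54 * (α + 2) *
          (1 - α + 6 * α * L.sigma 4 ^ 2 + 2 * L.sigma 4 ^ 2 - 8 * L.sigma 5 ^ 2) *
          L.lam ^ 2 * L.dx ^ 2) ∧
    -- third order, second family
    (∀ β : ℝ,
      L.SecondOrderRelaxation →
      L.sigma 5 = L.sigma 7 →
      L.sigma 5 ≠ 0 →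
      L.HeatFluxEquilibrium (-2) →
      L.NullThirdOrderEquilibrium →
      L.FourthDegreeEquilibrium β →
      L.sigma 10 = 1 / (12 * L.sigma 5) →
      L.sigma 11 = 1 / (12 * L.sigma 5) →
      L.sigma 12 = 1 / (12 * L.sigma 5) →
      L.sigma 23 = 1 / (12 * L.sigma 5) →
      L.sigma 24 = 1 / (4 * L.sigma 5) →
      L.sigma 25 = 1 / (8 * L.sigma 5) →
      L.IsotropicAtOrder 3 ∧
      ∃ μ ζ ξ χ : ℝ,
        L.equivOp 3 = LBM.acousticOp ((α + 2) / 3 * L.lam ^ 2) μ ζ ξ χ ∧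
        μ = 1 / 3 * L.sigma 5 * L.lam * L.dx ∧
        3 * ζ - μ = -(1 / 3) * L.sigma 4 * (1 + 3 * α) * L.lam * L.dx ∧
        ξ = 1 / 36 * (α - 1) * L.dx ^ 2 ∧
        χ = 1 / (162 * L.sigma 5) *
          (4 * L.sigma 5 + 2 * L.sigma 4 + 3 * α * L.sigma 4 - 6 * α * L.sigma 5
            - 3 * α ^ 2 * L.sigma 5 + 18 * α ^ 2 * L.sigma 4 ^ 2 * L.sigma 5
            + 42 * α * L.sigma 4 ^ 2 * L.sigma 5 + 12 * L.sigma 4 ^ 2 * L.sigma 5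
            - 24 * α * L.sigma 5 ^ 3 - 48 * L.sigma 5 ^ 3
            + β * L.sigma 4 - β * L.sigma 5) *
          L.lam ^ 2 * L.dx ^ 2) := by

  have h := hlam.ne'
  -- Converts the Δt λ² of the expansion into the λΔx of the viscosities.
  have hdt : L.dt * L.lam ^ 2 = L.lam * L.dx := by
    rw [LBM.D3Q27.dt]
    field_simp
  have hiso {l : ℕ} {c2 μ ζ ξ χ : ℝ} (hG : L.equivOp l = LBM.acousticOp c2 μ ζ ξ χ) :
      L.IsotropicAtOrder l := by
    rw [LBM.D3Q27.IsotropicAtOrder, hG]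
    exact LBM.acousticOp_isRotationInvariant _ _ _ _ _
  refine ⟨?_, fun hσ h57 hQ hN => ?_,
    fun hs2 hI => LBM.D3Q27.second_order_conditions_of_isotropic hlam hdx hs hE hs2 hI,
    fun hσ h57 hQ hN hF => ?_, fun β hσ h57 h5 hQ hN hF h10 h11 h12 _ _ _ => ?_⟩
  · have := LBM.D3Q27.equivOp_one_eq h hE
    exact ⟨hiso this, this⟩
  · have := LBM.D3Q27.equivOp_two_eq h hs hE hQ hN hσ (by field_simp)
    refine ⟨hiso this, _, _, this, ?_, ?_⟩
    · rw [mul_assoc _ L.lam, ← hdt]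
      field_simp
      ring
    · rw [mul_comm L.lam, mul_assoc _ L.lam, ← hdt]
      field_simp
      ring
  -- With β = -(2 + 3α) the defect of q vanishes, hence δ = 0.
  · have := LBM.D3Q27.equivOp_three_eq (δ := 0) h hs hE hQ hN hF hσ h57 (by ring) (by ring)
      (by ring) (by ring)
    exact ⟨hiso this, _, _, _, _, this, by ring, by ring, by ring, by ring⟩
  -- Here σ₅σ_k = 1/12 for k = 10, 11, 12, so the anisotropic weight vanishes for every β.
  · have hδ {s : ℝ} (hs : s = 1 / (12 * L.sigma 5)) :
        (3 * α + 2 + β) * s = (3 * α + 2 + β) / (12 * L.sigma 5) := by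
      rw [hs, mul_one_div]
    have := LBM.D3Q27.equivOp_three_eq h hs hE hQ hN hF hσ h57 (hδ h10) (hδ h11) (hδ h12)
      (by field_simp)
    refine ⟨hiso this, _, _, _, _, this, by ring, by ring, by ring, ?_⟩
    field_simp
    ring
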